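/- **Setting.** Let $\pi_X\neq\delta_0$ and $\mu_Z$ be probability measures on $\mathbb R$ with stretched exponential tails: for some $\alpha,C,c>0$ a variable $X$ with that law satisfies $\mathbb P(|X|>M)\le Ce^{-cM^\alpha}$ for all $M>0$. For every $N\ge1$ let $x=(x_1,\dots,x_N)$ have iid entries of law $\pi_X$, and let $Z=(Z_{ij})_{i,j\le N}$ be a random symmetric matrix, independent of $x$, whose entries $Z_{ij}$, $i\le j$, are iid with law $\mu_Z$. For $f:\mathbb R\to\mathbb R$ and $\gamma(N)\in\mathbb R$ define the symmetric matrix $Y^{(f)}$ by $$Y^{(f)}_{ij}=\frac1{\sqrt N}\Big[f\Big(Z_{ij}+\frac{\gamma(N)}{\sqrt N}x_ix_j\Big)-\mathbb E f(Z)\Big],\qquad Z\sim\mu_Z .$$ For smooth compactly supported $g$ put $\vartheta_k(g)=\mathbb E\,g^{(k)}(Z)$. **Assumptions on $f$.** $f\in L^4(\mu_Z)$, and $f$ is locally Lipschitz with polynomial constant: there are $C$ and $\beta\in\mathbb N$ with $|f(u)-f(v)|\le C(1+L)^\beta|u-v|$ whenever $L>0$ and $|u|,|v|\le L$. Moreover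 $f$ has an information index $k_\star\ge1$ with coefficient $\vartheta_{k_\star}(f)\ne0$. This means that there is a sequence $f_t\in C_c^\infty(\mathbb R)$ with $f_t\to f$ in $L^4(\mu_Z)$, $\vartheta_k(f_t)\to0$ for $1\le k<k_\star$ and $\vartheta_{k_\star}(f_t)\to\vartheta_{k_\star}(f)\neq0$ as $t\to\infty$, and that $k_\star$ and $\vartheta_{k_\star}(f)$ are determined by $f$ and $\mu_Z$: every sequence with these properties for some index and some non-zero limit has the same index and the same limit. **Theorem.** Assume also that $Q(\log N)\,|\gamma(N)|^{k_\star+1}/N^{k_\star/2}\to0$ as $N\to\infty$ for every polynomial $Q$. Then, for every $N\ge1$, there is on some probability space a decomposition in law $$Y^{(f)}\ \overset{\mathcal D}{=}\ \sqrt{\operatorname{Var} f(Z)}\;W+P+E$$ (jointly with $x$: on the right-hand side $P$ is formed with a copy of $x$, and $(x,Y^{(f)})$ has the same law as this copy together with the right-hand side), where 1. $W$ is a centered and normalized Wigner matrix with finite fourth moment: $W$ is symmetric and the entries $\sqrt N W_{ij}$, $i\le j$, are iid with a law that does not depend on $N$, has mean $0$ and variance $1$, and has a finite fourth moment; and $W$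 is independent of the copy of $x$, hence of $P$; 2. $$P=\frac{\gamma(N)^{k_\star}}{N^{\frac{k_\star}2-\frac12}}\,\frac{\vartheta_{k_\star}(f)}{k_\star!}\,\frac{x^{k_\star}}{\sqrt N}\Big(\frac{x^{k_\star}}{\sqrt N}\Big)^{\!\top},\qquad x^{k}=(x_1^{k},\dots,x_N^{k});$$ 3. $E$ is symmetric and, for every $\varepsilon>0$, satisfies $\|E\|_{\mathrm{op}}\le\varepsilon$ with high probability: there are $c,C>0$ independent of $N$ with $\mathbb P(\|E\|_{\mathrm{op}}\le\varepsilon)\ge1-CN^{-c}$ for all $N\ge1$. -/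

import Mathlib

open MeasureTheory ProbabilityTheory Filter Topology

noncomputable section

namespace NonlinearSpike

/-- `μ` has stretched exponential tails: for some `α, C, c > 0`, a random variable `X` with law `μ`
satisfies `P(|X| > M) ≤ C exp(-c M ^ α)` for every `M > 0`. -/
def StretchedExpTails (μ : Measure ℝ) : Prop :=
  ∃ α > (0 : ℝ), ∃ C > (0 : ℝ), ∃ c > (0 : ℝ), ∀ M > (0 : ℝ),
    μ.real {x | M < |x|} ≤ C * Real.exp (-c * M ^ α)

/-- `f` is locally Lipschitz and its Lipschitz constant on `[-L, L]` is bounded by a polynomial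
in `L`. -/
def LocLipschitzPoly (f : ℝ → ℝ) : Prop :=
  ∃ (C : ℝ) (β : ℕ), ∀ L > (0 : ℝ), ∀ x y : ℝ, |x| ≤ L → |y| ≤ L →
    |f x - f y| ≤ C * (1 + L) ^ β * |x - y|

/-- The `k`-th information coefficient `ϑ_k(f) = E f^{(k)}(Z)`, `Z ∼ μ`, of a smooth function. -/
def infoCoeff (μ : Measure ℝ) (k : ℕ) (f : ℝ → ℝ) : ℝ :=
  ∫ z, iteratedDeriv k f z ∂μ

/-- `(F t)` is a sequence of smooth compactly supported approximations of `f` in `L⁴(μ)` whose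
information coefficients of orders `1, …, k - 1` vanish in the limit and whose information
coefficient of order `k` tends to `θ ≠ 0`. -/
structure IsSmoothApprox (μ : Measure ℝ) (f : ℝ → ℝ) (k : ℕ) (θ : ℝ) (F : ℕ → ℝ → ℝ) :
    Prop where
  tendsto_L4 : Tendsto (fun t => eLpNorm (F t - f) 4 μ) atTop (𝓝 0)
  smooth : ∀ t, ContDiff ℝ ((⊤ : ℕ∞) : WithTop ℕ∞) (F t)
  hasCompactSupport : ∀ t, HasCompactSupport (F t)
  memLp_deriv : ∀ t, ∀ j ≤ k, MemLp (iteratedDeriv j (F t)) 4 μ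
  bounded_deriv : ∀ t, ∃ B : ℝ, ∀ x, |iteratedDeriv (k + 1) (F t) x| ≤ B
  one_le : 1 ≤ k
  tendsto_lower : ∀ j, 1 ≤ j → j < k → Tendsto (fun t => infoCoeff μ j (F t)) atTop (𝓝 0)
  tendsto_top : Tendsto (fun t => infoCoeff μ k (F t)) atTop (𝓝 θ)
  ne_zero : θ ≠ 0

/-- `k` is the generalized information index `k⋆` of `f` with respect to the noise distribution `μ`,
and `θ` is the information coefficient `ϑ_{k⋆}(f)`: smooth approximations that produce the values
`k` and `θ` exist, and no sequence of smooth approximations produces other values (so that both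
are functions of `f` and `μ` alone). -/
def IsInfoIndex (μ : Measure ℝ) (f : ℝ → ℝ) (k : ℕ) (θ : ℝ) : Prop :=
  (∃ F, IsSmoothApprox μ f k θ F) ∧
    ∀ (k' : ℕ) (θ' : ℝ) (F : ℕ → ℝ → ℝ), IsSmoothApprox μ f k' θ' F → k' = k ∧ θ' = θ

/-- A random family of reals is iid with law `μ`. -/
structure IsIID {Ω ι : Type*} [MeasurableSpace Ω] (X : ι → Ω → ℝ) (μ : Measure ℝ)
    (P : Measure Ω) : Prop where
  hasLaw : ∀ i, HasLaw (X i) μ P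
  indep : iIndepFun X P

/-- The index pairs `i ≤ j` of the independent entries of a symmetric `N × N` matrix. -/
abbrev UpperPair (N : ℕ) : Type := {p : Fin N × Fin N // p.1 ≤ p.2}

/-- A random matrix that is symmetric and whose entries `A i j`, `i ≤ j`, are iid with law `μ`. -/
structure IsSymmIID {Ω : Type*} [MeasurableSpace Ω] {N : ℕ}
    (A : Ω → Matrix (Fin N) (Fin N) ℝ) (μ : Measure ℝ) (P : Measure Ω) : Prop where
  symm : ∀ ω, (A ω).IsSymm
  iid : IsIID (fun (p : UpperPair N) ω => A ω p.1.1 p.1.2) μ P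

/-- `W N`, `N = 0, 1, …`, is a sequence of centered and normalized Wigner matrices with bounded
fourth moment: `W N` is symmetric, and the entries `√N W_{ij}`, `i ≤ j`, are iid with a law that
does not depend on `N`, has mean zero and variance one, and has a finite fourth moment. -/
def IsNormalizedWigner {Ω : ℕ → Type*} [∀ N, MeasurableSpace (Ω N)]
    (W : ∀ N, Ω N → Matrix (Fin N) (Fin N) ℝ) (P : ∀ N, Measure (Ω N)) : Prop :=
  ∃ ν : Measure ℝ, IsProbabilityMeasure ν ∧ MemLp id 4 ν ∧ ∫ w, w ∂ν = 0 ∧ ∫ w, w ^ 2 ∂ν = 1 ∧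
    ∀ N : ℕ, IsSymmIID (fun ω => √(N : ℝ) • W N ω) ν (P N)

/-- The matrix `Y^{(f)}` with entries
`N^{-1/2} (f(Z_{ij} + γ N^{-1/2} x_i x_j) - E f(Z))`, where `Z ∼ μ`. -/
def modelMatrix (μ : Measure ℝ) (f : ℝ → ℝ) (γ : ℝ) {N : ℕ} (x : Fin N → ℝ)
    (Z : Matrix (Fin N) (Fin N) ℝ) : Matrix (Fin N) (Fin N) ℝ :=
  Matrix.of fun i j =>
    1 / √(N : ℝ) * (f (Z i j + γ / √(N : ℝ) * x i * x j) - ∫ z, f z ∂μ)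

/-- The rank-one matrix
`P = γ^k / N^{k/2 - 1/2} · θ / k! · (x^k / √N) (x^k / √N)ᵀ`, with entrywise powers `x^k`. -/
def spikeMatrix (k : ℕ) (θ γ : ℝ) {N : ℕ} (x : Fin N → ℝ) : Matrix (Fin N) (Fin N) ℝ :=
  (γ ^ k / (N : ℝ) ^ ((k : ℝ) / 2 - 1 / 2) * (θ / (k.factorial : ℝ))) •
    Matrix.vecMulVec (fun i => x i ^ k / √(N : ℝ)) (fun i => x i ^ k / √(N : ℝ))

/-- The operator norm of a matrix with respect to the Euclidean norm. -/
def opNorm {N : ℕ} (A : Matrix (Fin N) (Fin N) ℝ) : ℝ :=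
  ‖Matrix.toEuclideanCLM (n := Fin N) (𝕜 := ℝ) A‖

/-- The events `S N` occur with high probability: `P(S N) ≥ 1 - C N^{-c}` for some `c, C > 0` and
all `N ≥ 1`. -/
def WithHighProbability {Ω : ℕ → Type*} [∀ N, MeasurableSpace (Ω N)] (P : ∀ N, Measure (Ω N))
    (S : ∀ N, Set (Ω N)) : Prop :=
  ∃ c > (0 : ℝ), ∃ C > (0 : ℝ), ∀ N : ℕ, 1 ≤ N →
    1 - C * (N : ℝ) ^ (-c) ≤ (P N).real (S N)

end NonlinearSpike

end

/-!
Given the signal, the entry `√N Y_{ij}` is `f(Z_{ij} + s) - E f(Z)` with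
`s = γ N^{-1/2} x_i x_j`. Splitting off `f(Z_{ij}) - E f(Z)`, which gives the Wigner matrix, leaves
the deterministic shift of the mean `E f(Z + s) - E f(Z)` and the centered increment
`f(Z_{ij} + s) - f(Z_{ij}) - E (f(Z + s) - f(Z))`. The spike is the leading Taylor term of the
shift of the mean. All random variables are realized on the product space of `modelLaw`.

*Shift of the mean.* The law of `Z` is not assumed to have a density, so there is no integration by
parts. It is replaced by the uniqueness of the information index, which forces each functional
`g ↦ ϑ_j(g)`, `1 ≤ j ≤ k`, to be continuous in `L⁴` (`IsInfoIndex.exists_infoCoeff_bound`):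
otherwise a null sequence with `ϑ_j = 1` could be added to the approximations of `f` and would
change its index or its coefficient. For a test function `g`, all derivatives of `s ↦ E g(Z + s)`
are coefficients of translates of `g`, and continuity of `ϑ_k` together with a Lipschitz bound on
`g` makes the `k`-th one Lipschitz. The resulting Taylor formula depends on `g` through its
Lipschitz constants only, so it passes to `f` along mollifications (`exists_abs_integral_shift_sub_le`), with
an error of order `|s|^{k+1}`. The Frobenius norm of the matrix of these errors is at most
`|γ|^{k+1} N^{-k/2}` times an empirical moment of the signal (`opNorm_bias_le`), and Chebyshev's
inequality bounds the latter. Applied to a constant function in place of `f`, the same formula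
shows that `Var f(Z) > 0` (`IsInfoIndex.variance_pos`).

*Centered increments.* Their moments of order `m` are of order `|s|^m`, and they are independent
given the signal. The moment method (`integral_trace_pow_le`) bounds the expected `2p`-th power of
the operator norm of their matrix by `N^{p+1} max |s|^{2p}` up to constants. Since `|γ| N^{-1/2}`
is at most of order `N^{-1/(2(k+1))}`, a large `p` yields the rate `1/N`
(`exists_noise_prob_le`).
-/

namespace NonlinearSpike

/-! ### Moments of laws with stretched exponential tails -/

theorem StretchedExpTails.integrable_abs_pow {μ : Measure ℝ} [IsProbabilityMeasure μ]
    (h : StretchedExpTails μ) (m : ℕ) : Integrable (fun x => |x| ^ m) μ := by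
  rcases Nat.eq_zero_or_pos m with rfl | hm
  · simp
  obtain ⟨α, hα, C, hC, c, hc, H⟩ := h
  refine ⟨by fun_prop, ?_⟩
  have key := lintegral_rpow_eq_lintegral_meas_lt_mul μ (f := fun x : ℝ => |x|)
    (ae_of_all _ fun x => abs_nonneg x) (by fun_prop) (p := m) (by exact_mod_cast hm)
  have hI : IntegrableOn (fun t : ℝ => t ^ ((m : ℝ) - 1) * Real.exp (-c * t ^ α)) (Set.Ioi 0) :=
    integrableOn_rpow_mul_exp_neg_mul_rpow
      (by have : (0 : ℝ) < m := by exact_mod_cast hm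
          linarith) hα hc
  have hI' := (hI.const_mul C).lintegral_lt_top
  have hle : ∫⁻ t in Set.Ioi (0 : ℝ), μ {a : ℝ | t < |a|} * ENNReal.ofReal (t ^ ((m : ℝ) - 1))
      ≤ ∫⁻ t in Set.Ioi (0 : ℝ),
        ENNReal.ofReal (C * (t ^ ((m : ℝ) - 1) * Real.exp (-c * t ^ α))) := by
    refine setLIntegral_mono' measurableSet_Ioi fun t ht => ?_
    rw [← ENNReal.ofReal_toReal (measure_ne_top μ {a : ℝ | t < |a|}),
      ← ENNReal.ofReal_mul ENNReal.toReal_nonneg]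
    refine ENNReal.ofReal_le_ofReal ?_
    have h1 := H t ht
    have h2 : 0 ≤ t ^ ((m : ℝ) - 1) := Real.rpow_nonneg (le_of_lt ht) _
    calc _ ≤ (C * Real.exp (-c * t ^ α)) * t ^ ((m : ℝ) - 1) :=
          mul_le_mul_of_nonneg_right h1 h2
      _ = _ := by ring
  rw [hasFiniteIntegral_iff_ofReal (ae_of_all _ fun x => by positivity)]
  simp only [Real.rpow_natCast] at key
  rw [key]
  exact ENNReal.mul_lt_top ENNReal.ofReal_lt_top (hle.trans_lt hI')

theorem StretchedExpTails.integrable_one_add_abs_pow {μ : Measure ℝ} [IsProbabilityMeasure μ]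
    (h : StretchedExpTails μ) (m : ℕ) : Integrable (fun x => (1 + |x|) ^ m) μ := by
  refine Integrable.mono' (((integrable_const (1 : ℝ)).add (h.integrable_abs_pow m)).const_mul
    (2 ^ (m - 1))) (by fun_prop) (ae_of_all _ fun x => ?_)
  rw [Real.norm_of_nonneg (by positivity)]
  simpa using add_pow_le zero_le_one (abs_nonneg x) m

theorem StretchedExpTails.memLp_one_add_abs_pow {μ : Measure ℝ} [IsProbabilityMeasure μ]
    (h : StretchedExpTails μ) (m : ℕ) (p : ℕ) : MemLp (fun x => (1 + |x|) ^ m) p μ := by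
  rcases Nat.eq_zero_or_pos p with rfl | hp
  · simpa using (by fun_prop : Continuous fun x : ℝ => (1 + |x|) ^ m).aestronglyMeasurable
  rw [← integrable_norm_rpow_iff (by fun_prop) (by simpa using hp.ne') (by simp)]
  simp only [ENNReal.toReal_natCast, Real.rpow_natCast, norm_pow, ← pow_mul]
  convert h.integrable_one_add_abs_pow (m * p) using 3 with x
  exact abs_of_nonneg (by positivity)

/-! ### Locally Lipschitz functions with polynomial constant -/

/-- `h` is Lipschitz on `[-L, L]` with constant `C (1 + L) ^ β`, and `|h 0| ≤ C`. Unlike in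
`LocLipschitzPoly`, the constants are parameters, so that the bound can be uniform over a family
of functions. -/
structure PolyLip (C : ℝ) (β : ℕ) (h : ℝ → ℝ) : Prop where
  nonneg : 0 ≤ C
  zero_le : |h 0| ≤ C
  lip : ∀ L, 0 ≤ L → ∀ x y, |x| ≤ L → |y| ≤ L → |h x - h y| ≤ C * (1 + L) ^ β * |x - y|

theorem LocLipschitzPoly.exists_polyLip {h : ℝ → ℝ} (hh : LocLipschitzPoly h) :
    ∃ C β, PolyLip C β h := by
  obtain ⟨C, β, H⟩ := hh
  refine ⟨|C| + |h 0|, β, by positivity, by linarith [abs_nonneg C], fun L hL x y hx hy => ?_⟩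
  rcases hL.eq_or_lt with rfl | hL
  · have hx0 : x = 0 := abs_nonpos_iff.1 hx
    have hy0 : y = 0 := abs_nonpos_iff.1 hy
    simp [hx0, hy0]
  · refine (H L hL x y hx hy).trans ?_
    gcongr
    linarith [le_abs_self C, abs_nonneg (h 0)]

theorem polyLip_const (c : ℝ) : PolyLip |c| 0 (fun _ => c) :=
  ⟨abs_nonneg c, le_rfl, fun L _ x y _ _ => by simpa using by positivity⟩

namespace PolyLip

variable {C : ℝ} {β : ℕ} {h : ℝ → ℝ}

theorem abs_le (hh : PolyLip C β h) (x : ℝ) : |h x| ≤ C * (1 + |x|) ^ (β + 1) := by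
  have h1 := hh.lip |x| (abs_nonneg x) x 0 le_rfl (by simp)
  have h2 : |h x| ≤ |h x - h 0| + |h 0| := by
    simpa using abs_add_le (h x - h 0) (h 0)
  have h3 : (1 : ℝ) ≤ (1 + |x|) ^ β := one_le_pow₀ (by linarith [abs_nonneg x])
  have h4 := hh.nonneg
  have h5 := hh.zero_le
  rw [sub_zero] at h1
  calc |h x| ≤ C * (1 + |x|) ^ β * |x| + C * 1 := by linarith
    _ ≤ C * (1 + |x|) ^ β * |x| + C * (1 + |x|) ^ β := by gcongr
    _ = _ := by ring

theorem abs_shift_sub_le (hh : PolyLip C β h) {S : ℝ} (x s : ℝ) (hs : |s| ≤ S) :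
    |h (x + s) - h x| ≤ C * (1 + S) ^ β * (1 + |x|) ^ β * |s| := by
  have hS : 0 ≤ S := (abs_nonneg s).trans hs
  have h1 := hh.lip (|x| + S) (by positivity) (x + s) x
    ((abs_add_le x s).trans (by linarith)) (by linarith)
  rw [add_sub_cancel_left] at h1
  refine h1.trans ?_
  have : (1 + (|x| + S)) ^ β ≤ (1 + S) ^ β * (1 + |x|) ^ β := by
    rw [← mul_pow]
    gcongr
    nlinarith [mul_nonneg hS (abs_nonneg x)]
  have h4 := hh.nonneg
  calc _ ≤ C * ((1 + S) ^ β * (1 + |x|) ^ β) * |s| := by gcongr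
    _ = _ := by ring

theorem continuous (hh : PolyLip C β h) : Continuous h := by
  rw [continuous_iff_continuousAt]
  intro x
  have hC := hh.nonneg
  refine continuousAt_of_locally_lipschitz (r := 1) one_pos (C * (1 + (|x| + 1)) ^ β)
    fun y hy => ?_
  rw [Real.dist_eq] at hy ⊢
  rw [Real.dist_eq]
  refine hh.lip (|x| + 1) (by positivity) y x ?_ (by linarith)
  have : |y| ≤ |y - x| + |x| := by simpa using abs_add_le (y - x) x
  linarith

/-- A shift of the argument costs only a factor polynomial in the shift. -/
theorem abs_comp_add_le (hh : PolyLip C β h) (x s : ℝ) :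
    |h (x + s)| ≤ C * (1 + |s|) ^ (β + 1) * (1 + |x|) ^ (β + 1) := by
  have hC := hh.nonneg
  refine (hh.abs_le (x + s)).trans ?_
  rw [mul_assoc, ← mul_pow]
  gcongr
  nlinarith [abs_add_le x s, mul_nonneg (abs_nonneg x) (abs_nonneg s)]

theorem memLp_comp_add {μ : Measure ℝ} [IsProbabilityMeasure μ] (hμ : StretchedExpTails μ)
    (hh : PolyLip C β h) (s : ℝ) (p : ℕ) : MemLp (fun z => h (z + s)) p μ := by
  have hC := hh.nonneg
  refine ((hμ.memLp_one_add_abs_pow (β + 1) p).const_mul (C * (1 + |s|) ^ (β + 1))).mono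
    (hh.continuous.comp (by fun_prop)).aestronglyMeasurable (ae_of_all _ fun x => ?_)
  rw [Real.norm_eq_abs, Real.norm_of_nonneg (by positivity)]
  exact hh.abs_comp_add_le x s

theorem memLp {μ : Measure ℝ} [IsProbabilityMeasure μ] (hμ : StretchedExpTails μ)
    (hh : PolyLip C β h) (p : ℕ) : MemLp h p μ := by
  simpa using hh.memLp_comp_add hμ 0 p

theorem integrable_comp_add {μ : Measure ℝ} [IsProbabilityMeasure μ] (hμ : StretchedExpTails μ)
    (hh : PolyLip C β h) (s : ℝ) : Integrable (fun z => h (z + s)) μ :=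
  memLp_one_iff_integrable.1 (by exact_mod_cast hh.memLp_comp_add hμ s 1)

theorem integrable {μ : Measure ℝ} [IsProbabilityMeasure μ] (hμ : StretchedExpTails μ)
    (hh : PolyLip C β h) : Integrable h μ := by
  simpa using hh.integrable_comp_add hμ 0

end PolyLip

/-! ### Continuity of the information coefficients in `L⁴` -/

/-- Smooth functions with compact support. -/
structure IsTest (g : ℝ → ℝ) : Prop where
  smooth : ContDiff ℝ ((⊤ : ℕ∞) : WithTop ℕ∞) g
  hasCompactSupport : HasCompactSupport g

namespace IsTest

variable {g h : ℝ → ℝ}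

theorem contDiffAt (hg : IsTest g) (j : ℕ) (x : ℝ) : ContDiffAt ℝ (j : WithTop ℕ∞) g x :=
  (hg.smooth.of_le (by exact_mod_cast le_top)).contDiffAt

theorem add (hg : IsTest g) (hh : IsTest h) : IsTest (g + h) :=
  ⟨hg.smooth.add hh.smooth, hg.hasCompactSupport.add hh.hasCompactSupport⟩

theorem const_smul (hg : IsTest g) (c : ℝ) : IsTest (c • g) :=
  ⟨hg.smooth.const_smul c, hg.hasCompactSupport.smul_left (f := fun _ => c)⟩

theorem neg (hg : IsTest g) : IsTest (-g) := by
  simpa using hg.const_smul (-1)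

theorem sub (hg : IsTest g) (hh : IsTest h) : IsTest (g - h) := by
  simpa [sub_eq_add_neg] using hg.add hh.neg

theorem comp_add_const (hg : IsTest g) (s : ℝ) : IsTest (fun z => g (z + s)) :=
  ⟨hg.smooth.comp (by fun_prop),
    hg.hasCompactSupport.comp_homeomorph (Homeomorph.addRight s)⟩

theorem isTest_iteratedDeriv (hg : IsTest g) (j : ℕ) : IsTest (iteratedDeriv j g) := by
  induction j with
  | zero => simpa using hg
  | succ j ih =>
    rw [iteratedDeriv_succ]
    exact ⟨((contDiff_infty_iff_deriv).1 ih.smooth).2, ih.hasCompactSupport.deriv⟩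

theorem continuous (hg : IsTest g) : Continuous g := hg.smooth.continuous

theorem exists_bound (hg : IsTest g) : ∃ B : ℝ, ∀ x, |g x| ≤ B := by
  obtain ⟨B, hB⟩ := hg.hasCompactSupport.exists_bound_of_continuous hg.continuous
  exact ⟨B, fun x => by simpa using hB x⟩

theorem memLp (hg : IsTest g) (μ : Measure ℝ) [IsProbabilityMeasure μ] (p : ENNReal) :
    MemLp g p μ := by
  obtain ⟨B, hB⟩ := hg.exists_bound
  exact MemLp.of_bound hg.continuous.aestronglyMeasurable B (ae_of_all _ fun x => by
    simpa using hB x)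

theorem integrable (hg : IsTest g) (μ : Measure ℝ) [IsProbabilityMeasure μ] : Integrable g μ :=
  memLp_one_iff_integrable.1 (hg.memLp μ 1)

theorem hasDerivAt_iteratedDeriv (hg : IsTest g) (j : ℕ) (x : ℝ) :
    HasDerivAt (iteratedDeriv j g) (iteratedDeriv (j + 1) g x) x := by
  rw [iteratedDeriv_succ]
  exact ((hg.isTest_iteratedDeriv j).smooth.differentiable (by simp)).differentiableAt.hasDerivAt

theorem infoCoeff_add (hg : IsTest g) (hh : IsTest h) (μ : Measure ℝ) [IsProbabilityMeasure μ]
    (j : ℕ) : infoCoeff μ j (g + h) = infoCoeff μ j g + infoCoeff μ j h := by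
  unfold infoCoeff
  rw [← integral_add ((hg.isTest_iteratedDeriv j).integrable μ)
    ((hh.isTest_iteratedDeriv j).integrable μ)]
  exact integral_congr_ae (ae_of_all _ fun x =>
    iteratedDeriv_add (hg.contDiffAt j x) (hh.contDiffAt j x))

theorem infoCoeff_const_smul (hg : IsTest g) (μ : Measure ℝ) (c : ℝ) (j : ℕ) :
    infoCoeff μ j (c • g) = c * infoCoeff μ j g := by
  unfold infoCoeff
  rw [← integral_const_mul]
  exact integral_congr_ae (ae_of_all _ fun x => by
    exact iteratedDeriv_const_smul (hg.contDiffAt j x) c)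

theorem infoCoeff_sub (hg : IsTest g) (hh : IsTest h) (μ : Measure ℝ) [IsProbabilityMeasure μ]
    (j : ℕ) : infoCoeff μ j (g - h) = infoCoeff μ j g - infoCoeff μ j h := by
  have := hg.infoCoeff_add (hh.const_smul (-1)) μ j
  rw [hh.infoCoeff_const_smul] at this
  rw [show g - h = g + (-1 : ℝ) • h by simp [sub_eq_add_neg], this]
  ring

end IsTest

/-- The inductive step for the continuity of `ϑ_j`: if `ϑ_i` is continuous for `i < j`, so is
`ϑ_j`. The uniqueness clause of `IsInfoIndex` enters here. If `ϑ_j` were unbounded, there would be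
`h t → 0` in `L⁴` with `ϑ_j (h t) = 1`, whose lower coefficients tend to zero by hypothesis. Adding
multiples of `h t` to the approximations of `f` would change the index or the coefficient. -/
theorem IsInfoIndex.exists_infoCoeff_bound_of_lower {μ : Measure ℝ} [IsProbabilityMeasure μ]
    {f : ℝ → ℝ} (hf4 : MemLp f 4 μ) {k : ℕ} {θ : ℝ}
    (hk : IsInfoIndex μ f k θ) {j : ℕ} (hj1 : 1 ≤ j) (hjk : j ≤ k)
    (hlow : ∀ i, 1 ≤ i → i < j → ∃ M : ℝ, ∀ g, IsTest g →
      |infoCoeff μ i g| ≤ M * (eLpNorm g 4 μ).toReal) :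
    ∃ M : ℝ, ∀ g, IsTest g → |infoCoeff μ j g| ≤ M * (eLpNorm g 4 μ).toReal := by
  obtain ⟨⟨F, hF⟩, huniq⟩ := hk
  by_contra! hcon
  have hex : ∀ t : ℕ, ∃ g, IsTest g ∧ infoCoeff μ j g = 1 ∧
      (eLpNorm g 4 μ).toReal ≤ 1 / ((t : ℝ) + 1) := by
    intro t
    obtain ⟨g, hg, hlt⟩ := hcon (t + 1)
    have hpos : 0 < |infoCoeff μ j g| := lt_of_le_of_lt (by positivity) hlt
    have hne : infoCoeff μ j g ≠ 0 := abs_pos.1 hpos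
    refine ⟨(infoCoeff μ j g)⁻¹ • g, hg.const_smul _, ?_, ?_⟩
    · rw [hg.infoCoeff_const_smul, inv_mul_cancel₀ hne]
    · rw [eLpNorm_const_smul, ENNReal.toReal_mul, le_div_iff₀ (by positivity)]
      simp only [toReal_enorm, norm_inv, Real.norm_eq_abs]
      rw [mul_assoc, inv_mul_le_iff₀ hpos]
      linarith
  choose h hh h1 hn using hex
  have hFt : ∀ t, IsTest (F t) := fun t => ⟨hF.smooth t, hF.hasCompactSupport t⟩
  have hn0 : Tendsto (fun t => (eLpNorm (h t) 4 μ).toReal) atTop (𝓝 0) :=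
    squeeze_zero (fun _ => ENNReal.toReal_nonneg) hn tendsto_one_div_add_atTop_nhds_zero_nat
  have hn0' : Tendsto (fun t => eLpNorm (h t) 4 μ) atTop (𝓝 0) := by
    have := ENNReal.tendsto_ofReal hn0
    simpa [ENNReal.ofReal_toReal ((hh _).memLp μ 4).eLpNorm_ne_top] using this
  have hG : ∀ t, IsTest (F t + θ • h t) := fun t => (hFt t).add ((hh t).const_smul θ)
  have hcoeff : ∀ i t, infoCoeff μ i (F t + θ • h t)
      = infoCoeff μ i (F t) + θ * infoCoeff μ i (h t) := fun i t => by
    rw [(hFt t).infoCoeff_add ((hh t).const_smul θ), (hh t).infoCoeff_const_smul]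
  have hL4 : Tendsto (fun t => eLpNorm (F t + θ • h t - f) 4 μ) atTop (𝓝 0) := by
    have hsum : Tendsto (fun t => eLpNorm (F t - f) 4 μ + ‖θ‖ₑ * eLpNorm (h t) 4 μ)
        atTop (𝓝 0) := by
      simpa using hF.tendsto_L4.add (ENNReal.Tendsto.const_mul hn0' (Or.inr enorm_ne_top))
    refine tendsto_of_tendsto_of_tendsto_of_le_of_le tendsto_const_nhds hsum
      (fun _ => zero_le) fun t => ?_
    rw [show F t + θ • h t - f = (F t - f) + θ • h t by abel, ← eLpNorm_const_smul]
    exact eLpNorm_add_le (((hFt t).memLp μ 4).sub hf4).1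
      (((hh t).const_smul θ).memLp μ 4).1 (by norm_num)
  have hlo : ∀ i, 1 ≤ i → i < j →
      Tendsto (fun t => infoCoeff μ i (F t + θ • h t)) atTop (𝓝 0) := by
    intro i hi hij
    obtain ⟨M, hM⟩ := hlow i hi hij
    have : Tendsto (fun t => infoCoeff μ i (h t)) atTop (𝓝 0) := by
      refine squeeze_zero_norm (fun t => ?_) (by simpa using hn0.const_mul M)
      simpa using hM (h t) (hh t)
    simp only [hcoeff]
    simpa using (hF.tendsto_lower i hi (by omega)).add (this.const_mul θ)
  have mk : ∀ θ', θ' ≠ 0 → Tendsto (fun t => infoCoeff μ j (F t + θ • h t)) atTop (𝓝 θ') →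
      IsSmoothApprox μ f j θ' (fun t => F t + θ • h t) := fun θ' h0 ht =>
    { tendsto_L4 := hL4
      smooth := fun t => (hG t).smooth
      hasCompactSupport := fun t => (hG t).hasCompactSupport
      memLp_deriv := fun t i _ => ((hG t).isTest_iteratedDeriv i).memLp μ 4
      bounded_deriv := fun t => ((hG t).isTest_iteratedDeriv (j + 1)).exists_bound
      one_le := hj1
      tendsto_lower := hlo
      tendsto_top := ht
      ne_zero := h0 }
  have hθ := hF.ne_zero
  -- For `j = k` the coefficient would be `2 θ ≠ θ`; for `j < k` the index would be `j`.
  rcases hjk.eq_or_lt with rfl | hlt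
  · have := (huniq j (θ + θ) _ (mk (θ + θ) (by simpa using hθ) (by
      simp only [hcoeff, h1, mul_one]
      exact hF.tendsto_top.add_const θ))).2
    exact hθ (by linarith)
  · have := (huniq j θ _ (mk θ hθ (by
      simp only [hcoeff, h1, mul_one]
      simpa using (hF.tendsto_lower j hj1 hlt).add_const θ))).1
    omega

/-- The information coefficients of orders `1, …, k` are continuous functionals for the norm of
`L⁴(μ)`. -/
theorem IsInfoIndex.exists_infoCoeff_bound {μ : Measure ℝ} [IsProbabilityMeasure μ]
    {f : ℝ → ℝ} (hf4 : MemLp f 4 μ) {k : ℕ} {θ : ℝ}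
    (hk : IsInfoIndex μ f k θ) {j : ℕ} (hj1 : 1 ≤ j) (hjk : j ≤ k) :
    ∃ M : ℝ, ∀ g, IsTest g → |infoCoeff μ j g| ≤ M * (eLpNorm g 4 μ).toReal := by
  induction j using Nat.strong_induction_on with
  | _ j ih =>
    exact hk.exists_infoCoeff_bound_of_lower hf4 hj1 hjk
      fun i hi hij => ih i hij hi (by omega)

/-! ### Smooth approximation of locally Lipschitz functions -/

/-- The piecewise linear cutoff function that is `1` on `[-R, R]` and `0` outside `[-2R, 2R]`. -/
noncomputable def cutoff (R x : ℝ) : ℝ := max 0 (min 1 (2 - |x| / R))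

theorem cutoff_nonneg (R x : ℝ) : 0 ≤ cutoff R x := le_max_left _ _

theorem cutoff_le_one (R x : ℝ) : cutoff R x ≤ 1 := max_le zero_le_one (min_le_left _ _)

theorem abs_cutoff_sub_le {R : ℝ} (hR : 1 ≤ R) (x y : ℝ) :
    |cutoff R x - cutoff R y| ≤ |x - y| := by
  have hR0 : 0 < R := by linarith
  have h1 : |cutoff R x - cutoff R y| ≤ |(2 - |x| / R) - (2 - |y| / R)| := by
    unfold cutoff
    refine (abs_max_sub_max_le_max _ _ _ _).trans ?_
    rw [sub_self, abs_zero, max_eq_right (abs_nonneg _)]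
    refine (abs_min_sub_min_le_max _ _ _ _).trans ?_
    rw [sub_self, abs_zero, max_eq_right (abs_nonneg _)]
  refine h1.trans ?_
  rw [show (2 - |x| / R) - (2 - |y| / R) = (|y| - |x|) / R by ring, abs_div, abs_of_pos hR0]
  refine (div_le_self (abs_nonneg _) hR).trans ?_
  rw [abs_sub_comm]
  exact abs_abs_sub_abs_le_abs_sub x y

theorem cutoff_eq_one {R x : ℝ} (hR : 0 < R) (hx : |x| ≤ R) : cutoff R x = 1 := by
  have : |x| / R ≤ 1 := (div_le_one hR).2 hx
  unfold cutoff
  rw [min_eq_left (by linarith), max_eq_right zero_le_one]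

theorem cutoff_eq_zero {R x : ℝ} (hR : 0 < R) (hx : 2 * R ≤ |x|) : cutoff R x = 0 := by
  have : 2 ≤ |x| / R := (le_div_iff₀ hR).2 hx
  unfold cutoff
  exact max_eq_left ((min_le_right _ _).trans (by linarith))

theorem hasCompactSupport_cutoff {R : ℝ} (hR : 0 < R) : HasCompactSupport (cutoff R) := by
  refine HasCompactSupport.intro (isCompact_Icc (a := -(2 * R)) (b := 2 * R)) fun x hx => ?_
  refine cutoff_eq_zero hR ?_
  by_contra! h
  exact hx ⟨(abs_lt.1 h).1.le, (abs_lt.1 h).2.le⟩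

theorem PolyLip.cutoff_mul {C : ℝ} {β : ℕ} {h : ℝ → ℝ} (hh : PolyLip C β h) {R : ℝ}
    (hR : 1 ≤ R) : PolyLip (2 * C) (β + 1) (fun x => cutoff R x * h x) := by
  have hC := hh.nonneg
  refine ⟨by linarith, ?_, fun L hL x y hx hy => ?_⟩
  · rw [cutoff_eq_one (by linarith) (by simp; linarith), one_mul]
    linarith [hh.zero_le]
  · have e : cutoff R x * h x - cutoff R y * h y
        = cutoff R x * (h x - h y) + (cutoff R x - cutoff R y) * h y := by ring
    have h1 : |cutoff R x * (h x - h y)| ≤ C * (1 + L) ^ (β + 1) * |x - y| := by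
      rw [abs_mul, abs_of_nonneg (cutoff_nonneg R x)]
      calc _ ≤ 1 * (C * (1 + L) ^ β * |x - y|) := by
            gcongr
            · exact cutoff_le_one R x
            · exact hh.lip L hL x y hx hy
        _ ≤ _ := by
            rw [one_mul]
            exact mul_le_mul_of_nonneg_right (mul_le_mul_of_nonneg_left
              (pow_le_pow_right₀ (by linarith) (Nat.le_succ _)) hC) (abs_nonneg _)
    have h2 : |(cutoff R x - cutoff R y) * h y| ≤ C * (1 + L) ^ (β + 1) * |x - y| := by
      rw [abs_mul]
      calc _ ≤ |x - y| * (C * (1 + |y|) ^ (β + 1)) :=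
            mul_le_mul (abs_cutoff_sub_le hR x y) (hh.abs_le y) (abs_nonneg _) (abs_nonneg _)
        _ ≤ |x - y| * (C * (1 + L) ^ (β + 1)) := by gcongr
        _ = _ := by ring
    rw [e]
    refine (abs_add_le _ _).trans ((add_le_add h1 h2).trans (le_of_eq (by ring)))

/-- The bump function used for mollification, supported in `[-1/(n+1), 1/(n+1)]`. -/
noncomputable def mollifier (n : ℕ) : ContDiffBump (0 : ℝ) where
  rIn := 1 / (2 * ((n : ℝ) + 1))
  rOut := 1 / ((n : ℝ) + 1)
  rIn_pos := by positivity
  rIn_lt_rOut := by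
    apply one_div_lt_one_div_of_lt (by positivity)
    linarith [(n.cast_nonneg : (0 : ℝ) ≤ n)]

open scoped Convolution

/-- Mollification of `h` at scale `1 / (n + 1)`. -/
noncomputable def mollify (n : ℕ) (h : ℝ → ℝ) : ℝ → ℝ :=
  (mollifier n).normed volume ⋆[ContinuousLinearMap.lsmul ℝ ℝ, volume] h

theorem isTest_mollify (n : ℕ) {h : ℝ → ℝ} (hc : Continuous h) (hs : HasCompactSupport h) :
    IsTest (mollify n h) :=
  ⟨(mollifier n).hasCompactSupport_normed.contDiff_convolution_left _
      (mollifier n).contDiff_normed hc.locallyIntegrable,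
    (mollifier n).hasCompactSupport_normed.convolution _ hs⟩

theorem PolyLip.abs_mollify_sub_le {C : ℝ} {β : ℕ} {h : ℝ → ℝ} (hh : PolyLip C β h) (n : ℕ)
    (x : ℝ) : |mollify n h x - h x| ≤ C * (2 + |x|) ^ β * (1 / ((n : ℝ) + 1)) := by
  have hC := hh.nonneg
  have h1 : 1 / ((n : ℝ) + 1) ≤ 1 := by
    rw [div_le_one (by positivity)]; linarith [(n.cast_nonneg : (0 : ℝ) ≤ n)]
  rw [← Real.dist_eq]
  refine ContDiffBump.dist_normed_convolution_le hh.continuous.aestronglyMeasurable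
    fun y hy => ?_
  rw [Metric.mem_ball, Real.dist_eq] at hy
  have hy' : |y - x| < 1 / ((n : ℝ) + 1) := hy
  rw [Real.dist_eq]
  have hyx : |y| ≤ |y - x| + |x| := by simpa using abs_add_le (y - x) x
  have := hh.lip (1 + |x|) (by positivity) y x (by linarith) (by linarith)
  refine this.trans ?_
  rw [show (1 : ℝ) + (1 + |x|) = 2 + |x| by ring]
  gcongr

theorem PolyLip.mollify {C : ℝ} {β : ℕ} {h : ℝ → ℝ} (hh : PolyLip C β h) (n : ℕ) :
    PolyLip (C * (1 + 2 ^ β)) β (mollify n h) := by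
  have hC := hh.nonneg
  have h1 : 1 / ((n : ℝ) + 1) ≤ 1 := by
    rw [div_le_one (by positivity)]; linarith [(n.cast_nonneg : (0 : ℝ) ≤ n)]
  set φ := (mollifier n).normed volume with hφ
  have hφc : Continuous φ := (mollifier n).continuous_normed
  have hint : ∀ x, Integrable (fun t => φ t * h (x - t)) := fun x =>
    (hφc.mul (hh.continuous.comp (by fun_prop))).integrable_of_hasCompactSupport
      ((mollifier n).hasCompactSupport_normed.mul_right)
  refine ⟨by positivity, ?_, fun L hL x y hx hy => ?_⟩
  · have h2 := hh.abs_mollify_sub_le n 0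
    have h3 : |NonlinearSpike.mollify n h 0| ≤ |NonlinearSpike.mollify n h 0 - h 0| + |h 0| := by
      simpa using abs_add_le (NonlinearSpike.mollify n h 0 - h 0) (h 0)
    have h4 : C * (2 + |(0 : ℝ)|) ^ β * (1 / ((n : ℝ) + 1)) ≤ C * 2 ^ β * 1 := by
      rw [abs_zero, add_zero]
      gcongr
    linarith [hh.zero_le]
  · have e : NonlinearSpike.mollify n h x - NonlinearSpike.mollify n h y
        = ∫ t, φ t * (h (x - t) - h (y - t)) := by
      simp only [NonlinearSpike.mollify, convolution, ContinuousLinearMap.lsmul_apply,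
        smul_eq_mul, ← hφ]
      rw [← integral_sub (hint x) (hint y)]
      simp only [mul_sub]
    have hb : ∀ t, ‖φ t * (h (x - t) - h (y - t))‖
        ≤ φ t * (C * (1 + (L + 1)) ^ β * |x - y|) := by
      intro t
      have hφ0 : 0 ≤ φ t := (mollifier n).nonneg_normed t
      rw [norm_mul, Real.norm_of_nonneg hφ0]
      by_cases ht : |t| < 1 / ((n : ℝ) + 1)
      · refine mul_le_mul_of_nonneg_left ?_ hφ0
        have := hh.lip (L + 1) (by positivity) (x - t) (y - t)
          ((abs_sub _ _).trans (by linarith)) ((abs_sub _ _).trans (by linarith))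
        simpa using this
      · have : φ t = 0 := by
          have hsupp := (mollifier n).support_normed_eq (μ := volume)
          by_contra hne
          have : t ∈ Function.support φ := hne
          rw [hφ, hsupp, Metric.mem_ball, dist_zero_right] at this
          exact ht this
        simp [this]
    have hφi : Integrable φ := (mollifier n).integrable_normed
    have h5 := norm_integral_le_of_norm_le (hφi.mul_const _) (ae_of_all _ hb)
    rw [integral_mul_const, (mollifier n).integral_normed, one_mul, ← e] at h5
    refine h5.trans ?_
    have h6 : (1 + (L + 1)) ^ β ≤ 2 ^ β * (1 + L) ^ β := by
      rw [← mul_pow]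
      gcongr
      linarith
    calc _ ≤ C * (2 ^ β * (1 + L) ^ β) * |x - y| := by gcongr
      _ ≤ C * ((1 + 2 ^ β) * (1 + L) ^ β) * |x - y| := by gcongr; linarith
      _ = _ := by ring

/-- Smooth compactly supported approximations that converge pointwise and obey one polynomial
Lipschitz bound. -/
theorem PolyLip.exists_approx {C : ℝ} {β : ℕ} {h : ℝ → ℝ} (hh : PolyLip C β h) :
    ∃ (C' : ℝ) (β' : ℕ) (g : ℕ → ℝ → ℝ), (∀ n, IsTest (g n)) ∧ (∀ n, PolyLip C' β' (g n)) ∧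
      ∀ x, Tendsto (fun n => g n x) atTop (𝓝 (h x)) := by
  have hR : ∀ n : ℕ, (1 : ℝ) ≤ (n : ℝ) + 1 := fun n => by
    linarith [(n.cast_nonneg : (0 : ℝ) ≤ n)]
  have hcut := fun n => hh.cutoff_mul (hR n)
  have hsupp : ∀ n : ℕ, HasCompactSupport fun x => cutoff ((n : ℝ) + 1) x * h x := fun n =>
    (hasCompactSupport_cutoff (by linarith [hR n])).mul_right
  refine ⟨_, _, fun n => NonlinearSpike.mollify n fun x => cutoff ((n : ℝ) + 1) x * h x,
    fun n => isTest_mollify n (hcut n).continuous (hsupp n),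
    fun n => (hcut n).mollify n, fun x => ?_⟩
  rw [tendsto_iff_norm_sub_tendsto_zero]
  have hz : Tendsto (fun n : ℕ => 2 * C * (2 + |x|) ^ (β + 1) * (1 / ((n : ℝ) + 1))) atTop
      (𝓝 0) := by
    simpa using tendsto_one_div_add_atTop_nhds_zero_nat.const_mul (2 * C * (2 + |x|) ^ (β + 1))
  refine squeeze_zero' (Eventually.of_forall fun n => norm_nonneg _) ?_ hz
  filter_upwards [eventually_ge_atTop ⌈|x|⌉₊] with n hn
  have hxn : |x| ≤ (n : ℝ) + 1 := by
    have := (Nat.le_ceil |x|).trans (Nat.cast_le.2 hn)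
    linarith
  have := (hcut n).abs_mollify_sub_le n x
  rwa [cutoff_eq_one (by linarith [hR n]) hxn, one_mul] at this

/-! ### Taylor expansion of the shifted mean -/

/-- Taylor's formula for a chain of derivatives whose last member is only Lipschitz at the
origin. -/
theorem abs_sub_taylor_le {K S : ℝ} (hK : 0 ≤ K) (k : ℕ) (Φ : ℕ → ℝ → ℝ)
    (hd : ∀ j < k, ∀ u, HasDerivAt (Φ j) (Φ (j + 1) u) u)
    (hlip : ∀ u, |u| ≤ S → |Φ k u - Φ k 0| ≤ K * |u|) {s : ℝ} (hs : |s| ≤ S) :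
    |Φ 0 s - ∑ j ∈ Finset.range (k + 1), Φ j 0 * s ^ j / (j.factorial : ℝ)|
      ≤ K * |s| ^ (k + 1) := by
  induction k generalizing Φ s with
  | zero => simpa using hlip s hs
  | succ k ih =>
    have ih' := fun (u : ℝ) (hu : |u| ≤ S) =>
      ih (fun j => Φ (j + 1)) (fun j hj => hd (j + 1) (by omega)) hlip hu
    simp only [zero_add] at ih'
    set R : ℝ → ℝ := fun u =>
      Φ 0 u - ∑ j ∈ Finset.range (k + 1 + 1), Φ j 0 * u ^ j / (j.factorial : ℝ) with hR
    set R' : ℝ → ℝ := fun u =>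
      Φ 1 u - ∑ j ∈ Finset.range (k + 1), Φ (j + 1) 0 * u ^ j / (j.factorial : ℝ) with hR'
    have hderiv : ∀ u, HasDerivAt R (R' u) u := by
      intro u
      refine (hd 0 (by omega) u).sub ?_
      simp only [Finset.sum_range_succ' _ (k + 1)]
      have h0 : HasDerivAt (fun u : ℝ => ∑ j ∈ Finset.range (k + 1),
          Φ (j + 1) 0 * u ^ (j + 1) / ((j + 1).factorial : ℝ))
          (∑ j ∈ Finset.range (k + 1), Φ (j + 1) 0 * u ^ j / (j.factorial : ℝ)) u := by
        refine HasDerivAt.fun_sum fun j _ => ?_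
        have h1 := ((hasDerivAt_pow (j + 1) u).const_mul (Φ (j + 1) 0)).div_const
          ((j + 1).factorial : ℝ)
        refine h1.congr_deriv ?_
        have : (j.factorial : ℝ) ≠ 0 := by positivity
        rw [Nat.factorial_succ]
        push_cast
        field_simp
      simpa using h0.add_const (Φ 0 0)
    have hmv := Convex.norm_image_sub_le_of_norm_hasDerivWithin_le (f := R) (f' := R')
      (s := Set.uIcc 0 s) (C := K * |s| ^ (k + 1)) (x := 0) (y := s)
      (fun u _ => (hderiv u).hasDerivWithinAt) (fun u hu => by
        have hus : |u| ≤ |s| := by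
          simpa using Set.abs_sub_left_of_mem_uIcc hu
        refine (ih' u (hus.trans hs)).trans ?_
        gcongr) (convex_uIcc 0 s) Set.left_mem_uIcc Set.right_mem_uIcc
    have hR0 : R 0 = 0 := by simp [hR, Finset.sum_range_succ']
    rw [hR0, sub_zero, sub_zero, Real.norm_eq_abs, Real.norm_eq_abs, mul_assoc, ← pow_succ] at hmv
    exact hmv

theorem IsTest.hasDerivAt_integral {g : ℝ → ℝ} (hg : IsTest g) (μ : Measure ℝ)
    [IsProbabilityMeasure μ] (j : ℕ) (s : ℝ) :
    HasDerivAt (fun u => ∫ z, iteratedDeriv j g (z + u) ∂μ)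
      (∫ z, iteratedDeriv (j + 1) g (z + s) ∂μ) s := by
  obtain ⟨B, hB⟩ := (hg.isTest_iteratedDeriv (j + 1)).exists_bound
  have hc := fun i => (hg.isTest_iteratedDeriv i).continuous
  refine (hasDerivAt_integral_of_dominated_loc_of_deriv_le (bound := fun _ => B)
    (F := fun u z => iteratedDeriv j g (z + u))
    (F' := fun u z => iteratedDeriv (j + 1) g (z + u)) univ_mem
    (Eventually.of_forall fun u => ((hc j).comp (by fun_prop)).aestronglyMeasurable)
    (((hg.isTest_iteratedDeriv j).comp_add_const s).integrable μ)
    ((hc (j + 1)).comp (by fun_prop)).aestronglyMeasurable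
    (ae_of_all _ fun z u _ => by simpa using hB (z + u)) (integrable_const B)
    (ae_of_all _ fun z u _ => ?_)).2
  simpa using (hg.hasDerivAt_iteratedDeriv j (z + u)).comp_const_add z u

theorem IsTest.integral_iteratedDeriv_shift {g : ℝ → ℝ} (μ : Measure ℝ) (j : ℕ) (s : ℝ) :
    ∫ z, iteratedDeriv j g (z + s) ∂μ = infoCoeff μ j (fun z => g (z + s)) := by
  simp only [infoCoeff, iteratedDeriv_comp_add_const]

/-- The Taylor bound for test functions. Only the `L⁴` continuity of `ϑ_k` and the Lipschitz
constants of `g` enter the constant, not the derivatives of `g`. -/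
theorem IsTest.abs_integral_shift_sub_taylor_le {μ : Measure ℝ} [IsProbabilityMeasure μ]
    (hμ : StretchedExpTails μ) {k : ℕ} {M : ℝ} (hM0 : 0 ≤ M)
    (hM : ∀ g, IsTest g → |infoCoeff μ k g| ≤ M * (eLpNorm g 4 μ).toReal)
    {C : ℝ} {β : ℕ} {g : ℝ → ℝ} (hg : IsTest g) (hgl : PolyLip C β g) (s : ℝ) :
    |∫ z, g (z + s) ∂μ
        - ∑ j ∈ Finset.range (k + 1), infoCoeff μ j g * s ^ j / (j.factorial : ℝ)|
      ≤ M * C * (eLpNorm (fun x : ℝ => (1 + |x|) ^ β) 4 μ).toReal * (1 + |s|) ^ β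
        * |s| ^ (k + 1) := by
  have hC := hgl.nonneg
  have key := abs_sub_taylor_le (K := M * C * (eLpNorm (fun x : ℝ => (1 + |x|) ^ β) 4 μ).toReal
    * (1 + |s|) ^ β) (S := |s|) (by positivity) k
    (fun j u => ∫ z, iteratedDeriv j g (z + u) ∂μ)
    (fun j _ u => hg.hasDerivAt_integral μ j u) (fun u hu => ?_) le_rfl
  · simpa [infoCoeff] using key
  · have hgu := hg.comp_add_const u
    have h0 : ∫ z, iteratedDeriv k g (z + 0) ∂μ = infoCoeff μ k g := by simp [infoCoeff]
    rw [IsTest.integral_iteratedDeriv_shift, h0, ← hgu.infoCoeff_sub hg]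
    refine (hM _ (hgu.sub hg)).trans ?_
    have hle : eLpNorm ((fun z => g (z + u)) - g) 4 μ
        ≤ eLpNorm ((C * (1 + |s|) ^ β * |u|) • fun x : ℝ => (1 + |x|) ^ β) 4 μ := by
      refine eLpNorm_mono fun x => ?_
      simp only [Pi.sub_apply, Pi.smul_apply, smul_eq_mul, Real.norm_eq_abs]
      rw [abs_of_nonneg (a := _ * (1 + |x|) ^ β) (by positivity)]
      exact (hgl.abs_shift_sub_le x u hu).trans (le_of_eq (by ring))
    rw [eLpNorm_const_smul] at hle
    have hfin : eLpNorm (fun x : ℝ => (1 + |x|) ^ β) 4 μ ≠ ⊤ :=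
      (by exact_mod_cast hμ.memLp_one_add_abs_pow β 4 :
        MemLp (fun x : ℝ => (1 + |x|) ^ β) 4 μ).eLpNorm_ne_top
    have hle' := ENNReal.toReal_mono (ENNReal.mul_ne_top enorm_ne_top hfin) hle
    rw [ENNReal.toReal_mul, toReal_enorm, Real.norm_of_nonneg (by positivity)] at hle'
    calc _ ≤ M * (C * (1 + |s|) ^ β * |u|
          * (eLpNorm (fun x : ℝ => (1 + |x|) ^ β) 4 μ).toReal) := by gcongr
      _ = _ := by ring

theorem PolyLip.tendsto_eLpNorm_sub {μ : Measure ℝ} [IsProbabilityMeasure μ]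
    (hμ : StretchedExpTails μ) {C : ℝ} {β : ℕ} {g : ℕ → ℝ → ℝ} {h : ℝ → ℝ} {C' : ℝ} {β' : ℕ}
    (hg : ∀ n, PolyLip C β (g n)) (hh : PolyLip C' β' h)
    (hlim : ∀ x, Tendsto (fun n => g n x) atTop (𝓝 (h x))) :
    Tendsto (fun n => eLpNorm (g n - h) 4 μ) atTop (𝓝 0) := by
  have h4 : MemLp h 4 μ := by exact_mod_cast hh.memLp hμ 4
  have hG : MemLp (fun x : ℝ => C * (1 + |x|) ^ (β + 1)) 4 μ := by
    exact_mod_cast (hμ.memLp_one_add_abs_pow (β + 1) 4).const_mul C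
  refine tendsto_Lp_finite_of_tendsto_ae (by norm_num) (by norm_num)
    (fun n => (hg n).continuous.aestronglyMeasurable) h4 ?_ (ae_of_all _ hlim)
  intro ε hε
  obtain ⟨δ, hδ, H⟩ := unifIntegrable_const (ι := ℕ) (by norm_num) (by norm_num) hG hε
  refine ⟨δ, hδ, fun n s hs hμs => (eLpNorm_mono fun x => ?_).trans (H n s hs hμs)⟩
  by_cases hx : x ∈ s
  · simp only [Set.indicator_of_mem hx, Real.norm_eq_abs]
    exact ((hg n).abs_le x).trans (le_abs_self _)
  · simp [Set.indicator_of_notMem hx]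

/-- If the lower information coefficients vanish along one `L⁴` approximation of `h` by test
functions, the mean `E h(Z + s)` is constant up to the term `θ s ^ k / k!` and an error of order
`|s| ^ (k + 1)`. -/
theorem exists_abs_integral_shift_sub_le {μ : Measure ℝ} [IsProbabilityMeasure μ]
    (hμ : StretchedExpTails μ) {k : ℕ} (hk1 : 1 ≤ k) {θ : ℝ}
    (hM : ∀ j, 1 ≤ j → j ≤ k → ∃ M : ℝ, ∀ g, IsTest g →
      |infoCoeff μ j g| ≤ M * (eLpNorm g 4 μ).toReal)
    {h : ℝ → ℝ} {C : ℝ} {β : ℕ} (hh : PolyLip C β h) {F : ℕ → ℝ → ℝ} (hF : ∀ t, IsTest (F t))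
    (hF4 : Tendsto (fun t => eLpNorm (F t - h) 4 μ) atTop (𝓝 0))
    (hlow : ∀ j, 1 ≤ j → j < k → Tendsto (fun t => infoCoeff μ j (F t)) atTop (𝓝 0))
    (htop : Tendsto (fun t => infoCoeff μ k (F t)) atTop (𝓝 θ)) :
    ∃ (K : ℝ) (b : ℕ), 0 ≤ K ∧ ∀ s : ℝ,
      |∫ z, h (z + s) ∂μ - ∫ z, h z ∂μ - θ * s ^ k / (k.factorial : ℝ)|
        ≤ K * (1 + |s|) ^ b * |s| ^ (k + 1) := by
  obtain ⟨C', β', g, hg, hgl, hlim⟩ := hh.exists_approx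
  have hC' := (hgl 0).nonneg
  have hg4 := PolyLip.tendsto_eLpNorm_sub hμ hgl hh hlim
  have hdiff : Tendsto (fun n => (eLpNorm (g n - F n) 4 μ).toReal) atTop (𝓝 0) := by
    have h4 : MemLp h 4 μ := by exact_mod_cast hh.memLp hμ 4
    have hsum : Tendsto (fun n => eLpNorm (g n - h) 4 μ + eLpNorm (F n - h) 4 μ) atTop
        (𝓝 0) := by simpa using hg4.add hF4
    have : Tendsto (fun n => eLpNorm (g n - F n) 4 μ) atTop (𝓝 0) := by
      refine tendsto_of_tendsto_of_tendsto_of_le_of_le tendsto_const_nhds hsum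
        (fun _ => zero_le) fun n => ?_
      rw [show g n - F n = (g n - h) - (F n - h) by abel]
      exact eLpNorm_sub_le (((hg n).memLp μ 4).sub h4).1 (((hF n).memLp μ 4).sub h4).1
        (by norm_num)
    exact (ENNReal.tendsto_toReal ENNReal.zero_ne_top).comp this
  have hsame : ∀ j, 1 ≤ j → j ≤ k →
      Tendsto (fun n => infoCoeff μ j (g n) - infoCoeff μ j (F n)) atTop (𝓝 0) := by
    intro j hj1 hjk
    obtain ⟨M, hM⟩ := hM j hj1 hjk
    refine squeeze_zero_norm (fun n => ?_) (by simpa using hdiff.const_mul M)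
    rw [← (hg n).infoCoeff_sub (hF n)]
    exact hM _ ((hg n).sub (hF n))
  have hint : ∀ s, Tendsto (fun n => ∫ z, g n (z + s) ∂μ) atTop (𝓝 (∫ z, h (z + s) ∂μ)) := by
    intro s
    refine tendsto_integral_of_dominated_convergence
      (fun x => C' * (1 + |s|) ^ (β' + 1) * (1 + |x|) ^ (β' + 1))
      (fun n => ((hgl n).continuous.comp (by fun_prop)).aestronglyMeasurable)
      ((hμ.integrable_one_add_abs_pow _).const_mul _)
      (fun n => ae_of_all _ fun x => (hgl n).abs_comp_add_le x s)
      (ae_of_all _ fun x => hlim (x + s))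
  obtain ⟨M, hMk⟩ := hM k hk1 le_rfl
  have hMk' : ∀ g, IsTest g → |infoCoeff μ k g| ≤ |M| * (eLpNorm g 4 μ).toReal := fun g hg =>
    (hMk g hg).trans (by gcongr; exact le_abs_self M)
  refine ⟨|M| * C' * (eLpNorm (fun x : ℝ => (1 + |x|) ^ β') 4 μ).toReal, β', by positivity,
    fun s => ?_⟩
  have hbound := fun n =>
    (hg n).abs_integral_shift_sub_taylor_le hμ (abs_nonneg M) hMk' (hgl n) s
  have hsum : Tendsto (fun n => ∑ j ∈ Finset.range (k + 1),
      infoCoeff μ j (g n) * s ^ j / (j.factorial : ℝ)) atTop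
      (𝓝 (∫ z, h z ∂μ + θ * s ^ k / (k.factorial : ℝ))) := by
    obtain ⟨m, rfl⟩ : ∃ m, k = m + 1 := ⟨k - 1, by omega⟩
    simp only [Finset.sum_range_succ _ (m + 1), Finset.sum_range_succ' _ m]
    have h0 : Tendsto (fun n => infoCoeff μ 0 (g n)) atTop (𝓝 (∫ z, h z ∂μ)) := by
      simpa [infoCoeff] using hint 0
    have h1 : Tendsto (fun n => infoCoeff μ (m + 1) (g n)) atTop (𝓝 θ) := by
      simpa using (hsame (m + 1) hk1 le_rfl).add htop
    have h2 : Tendsto (fun n => ∑ j ∈ Finset.range m,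
        infoCoeff μ (j + 1) (g n) * s ^ (j + 1) / ((j + 1).factorial : ℝ)) atTop (𝓝 0) := by
      rw [show (0 : ℝ) = ∑ j ∈ Finset.range m,
        (0 : ℝ) * s ^ (j + 1) / ((j + 1).factorial : ℝ) by simp]
      refine tendsto_finsetSum _ fun j hj => ?_
      have hj' := Finset.mem_range.1 hj
      have h3 : Tendsto (fun n => infoCoeff μ (j + 1) (g n)) atTop (𝓝 0) := by
        simpa using (hsame (j + 1) (by omega) (by omega)).add
          (hlow (j + 1) (by omega) (by omega))
      exact (h3.mul_const _).div_const _
    simpa using (h2.add h0).add ((h1.mul_const (s ^ (m + 1))).div_const ((m + 1).factorial : ℝ))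
  have hlimit := ((hint s).sub hsum).abs
  rw [← sub_sub] at hlimit
  exact le_of_tendsto' hlimit hbound

/-- A constant function has no information index, because its shifted means do not move. Hence
`f(Z)` is not almost surely constant. -/
theorem IsInfoIndex.not_ae_const {μ : Measure ℝ} [IsProbabilityMeasure μ]
    (hμ : StretchedExpTails μ) {f : ℝ → ℝ} (hf4 : MemLp f 4 μ) {k : ℕ} {θ : ℝ}
    (hk : IsInfoIndex μ f k θ) (c : ℝ) : ¬ f =ᵐ[μ] fun _ => c := by
  intro hfc
  obtain ⟨F, hF⟩ := hk.1
  obtain ⟨K, b, hK, H⟩ := exists_abs_integral_shift_sub_le hμ hF.one_le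
    (fun j h1 h2 => hk.exists_infoCoeff_bound hf4 h1 h2) (polyLip_const c)
    (fun t => ⟨hF.smooth t, hF.hasCompactSupport t⟩)
    (by
      refine hF.tendsto_L4.congr fun t => eLpNorm_congr_ae ?_
      filter_upwards [hfc] with x hx
      simp [hx])
    hF.tendsto_lower hF.tendsto_top
  have h1 : ∀ s : ℝ, 0 < s → s ≤ 1 → |θ| ≤ (k.factorial : ℝ) * (K * 2 ^ b) * s := by
    intro s hs hs1
    have h := H s
    simp only [sub_self, zero_sub, abs_neg, abs_div, abs_mul, abs_pow, Nat.abs_cast,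
      abs_of_pos hs] at h
    rw [div_le_iff₀ (by positivity), pow_succ] at h
    have h2 : |θ| * s ^ k ≤ (k.factorial : ℝ) * (K * 2 ^ b) * s * s ^ k := by
      refine h.trans ?_
      have : (1 + s) ^ b ≤ 2 ^ b := by gcongr; linarith
      calc _ ≤ K * 2 ^ b * (s ^ k * s) * (k.factorial : ℝ) := by gcongr
        _ = _ := by ring
    exact le_of_mul_le_mul_right h2 (by positivity)
  have hlim : Tendsto (fun s : ℝ => (k.factorial : ℝ) * (K * 2 ^ b) * s) (𝓝[>] 0) (𝓝 0) := by
    have : Continuous fun s : ℝ => (k.factorial : ℝ) * (K * 2 ^ b) * s := by fun_prop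
    simpa using (this.tendsto 0).mono_left nhdsWithin_le_nhds
  have h0 : |θ| ≤ 0 := by
    refine ge_of_tendsto hlim ?_
    filter_upwards [Ioc_mem_nhdsGT (zero_lt_one (α := ℝ))] with s hs
    exact h1 s hs.1 hs.2
  exact hF.ne_zero (abs_nonpos_iff.1 h0)

/-! ### Operator norm, Frobenius norm and traces of powers -/

theorem opNorm_nonneg {N : ℕ} (A : Matrix (Fin N) (Fin N) ℝ) : 0 ≤ opNorm A := norm_nonneg _

theorem opNorm_add_le {N : ℕ} (A B : Matrix (Fin N) (Fin N) ℝ) :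
    opNorm (A + B) ≤ opNorm A + opNorm B := by
  simpa [opNorm] using norm_add_le (Matrix.toEuclideanCLM (n := Fin N) (𝕜 := ℝ) A) _

theorem opNorm_smul {N : ℕ} (c : ℝ) (A : Matrix (Fin N) (Fin N) ℝ) :
    opNorm (c • A) = |c| * opNorm A := by
  simp [opNorm, norm_smul]

theorem opNorm_sq_le_sum_sq {N : ℕ} (A : Matrix (Fin N) (Fin N) ℝ) :
    opNorm A ^ 2 ≤ ∑ i, ∑ j, A i j ^ 2 := by
  have h0 : 0 ≤ ∑ i, ∑ j, A i j ^ 2 := by positivity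
  have h : opNorm A ≤ √(∑ i, ∑ j, A i j ^ 2) := by
    refine ContinuousLinearMap.opNorm_le_bound _ (Real.sqrt_nonneg _) fun v => ?_
    rw [EuclideanSpace.norm_eq, EuclideanSpace.norm_eq, ← Real.sqrt_mul h0]
    refine Real.sqrt_le_sqrt ?_
    rw [Finset.sum_mul]
    refine Finset.sum_le_sum fun i _ => ?_
    rw [Matrix.ofLp_toEuclideanCLM]
    simp only [Real.norm_eq_abs, sq_abs]
    exact Finset.sum_mul_sq_le_sq_mul_sq Finset.univ (fun j => A i j) (fun j => v j)
  calc opNorm A ^ 2 ≤ √(∑ i, ∑ j, A i j ^ 2) ^ 2 := by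
        gcongr
        exact opNorm_nonneg A
    _ = _ := Real.sq_sqrt h0

theorem isSymm_pow {N : ℕ} {A : Matrix (Fin N) (Fin N) ℝ} (hA : A.IsSymm) (n : ℕ) :
    (A ^ n).IsSymm := by
  rw [Matrix.IsSymm, Matrix.transpose_pow, hA.eq]

open scoped Matrix.Norms.L2Operator in
/-- The moment method. Powers of two suffice, since `‖A ^ 2 ^ q‖ = ‖A‖ ^ 2 ^ q` is then iterated
from the C⋆-identity. -/
theorem opNorm_pow_le_trace {N : ℕ} {A : Matrix (Fin N) (Fin N) ℝ} (hA : A.IsSymm) (q : ℕ) :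
    opNorm A ^ (2 * 2 ^ q) ≤ (A ^ (2 * 2 ^ q)).trace := by
  have hsa : IsSelfAdjoint A := by
    rw [isSelfAdjoint_iff, Matrix.star_eq_conjTranspose,
      Matrix.conjTranspose_eq_transpose_of_trivial]
    exact hA
  have h1 : opNorm (A ^ 2 ^ q) = opNorm A ^ 2 ^ q := by
    simp only [opNorm, Matrix.l2_opNorm_toEuclideanCLM]
    simpa using congrArg NNReal.toReal (hsa.nnnorm_pow_two_pow q)
  rw [mul_comm, pow_mul, ← h1, pow_mul]
  refine (opNorm_sq_le_sum_sq _).trans (le_of_eq ?_)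
  rw [Matrix.trace]
  refine Finset.sum_congr rfl fun i _ => ?_
  rw [Matrix.diag_apply, sq (A ^ 2 ^ q), Matrix.mul_apply]
  refine Finset.sum_congr rfl fun j _ => ?_
  rw [sq, (isSymm_pow hA _).apply i j]

theorem pow_apply_eq_sum_paths {ι : Type*} [Fintype ι] [DecidableEq ι] (A : Matrix ι ι ℝ) (n : ℕ)
    (a b : ι) : (A ^ n) a b = ∑ w : Fin (n + 1) → ι,
      if w 0 = a ∧ w (Fin.last n) = b then ∏ t : Fin n, A (w t.castSucc) (w t.succ) else 0 := by
  induction n generalizing a with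
  | zero =>
    rw [← (Equiv.funUnique (Fin 1) ι).symm.sum_comp]
    simp only [pow_zero, Matrix.one_apply]
    by_cases hab : a = b
    · subst hab
      rw [Finset.sum_eq_single a] <;> simp +contextual
    · rw [if_neg hab, Finset.sum_eq_zero]
      intro c _
      refine if_neg fun h => hab ?_
      exact h.1.symm.trans h.2
  | succ n ih =>
    rw [pow_succ', Matrix.mul_apply, ← (Fin.consEquiv fun _ : Fin (n + 2) => ι).sum_comp,
      Fintype.sum_prod_type]
    have hstep : ∀ (a' : ι) (w : Fin (n + 1) → ι),
        (∏ t : Fin (n + 1), A ((Fin.cons a' w : Fin (n + 2) → ι) t.castSucc)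
          ((Fin.cons a' w : Fin (n + 2) → ι) t.succ))
        = A a' (w 0) * ∏ t : Fin n, A (w t.castSucc) (w t.succ) := by
      intro a' w
      rw [Fin.prod_univ_succ]
      simp
    have hcons : ∀ (a' : ι) (w : Fin (n + 1) → ι),
        (Fin.consEquiv fun _ : Fin (n + 2) => ι) (a', w) = (Fin.cons a' w : Fin (n + 2) → ι) :=
      fun _ _ => rfl
    simp only [hcons, hstep]
    simp only [Fin.cons_zero, ← Fin.succ_last, Fin.cons_succ]
    rw [Finset.sum_eq_single a (fun c _ hc => Finset.sum_eq_zero fun w _ => by simp [hc])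
      (by simp)]
    simp only [ih, Finset.mul_sum, true_and]
    rw [Finset.sum_comm]
    refine Finset.sum_congr rfl fun w _ => ?_
    rw [Finset.sum_eq_single (w 0) (fun c _ hc => by simp [Ne.symm hc]) (by simp)]
    simp

theorem trace_pow_eq_sum_paths {ι : Type*} [Fintype ι] [DecidableEq ι] (A : Matrix ι ι ℝ)
    (n : ℕ) : (A ^ n).trace = ∑ w : Fin (n + 1) → ι,
      if w (Fin.last n) = w 0 then ∏ t : Fin n, A (w t.castSucc) (w t.succ) else 0 := by
  simp only [Matrix.trace, Matrix.diag_apply, pow_apply_eq_sum_paths]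
  rw [Finset.sum_comm]
  refine Finset.sum_congr rfl fun w _ => ?_
  rw [Finset.sum_eq_single (w 0) (fun c _ hc => by simp [Ne.symm hc]) (by simp)]
  simp

/-! ### Counting paths without simple edges -/

/-- A path visits at most one vertex more than it has distinct edges: each new vertex is reached
by a new edge. -/
theorem card_vertices_le_card_edges_add_one {V T : Type*} [DecidableEq V] [DecidableEq T]
    (ε : V → V → T)
    (hε : ∀ a b c d, ε a b = ε c d → b = c ∨ b = d) (W : ℕ → V) (m : ℕ) :
    ((Finset.range (m + 1)).image W).card
      ≤ ((Finset.range m).image fun t => ε (W t) (W (t + 1))).card + 1 := by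
  induction m with
  | zero => simp
  | succ m ih =>
    rw [Finset.range_add_one (n := m + 1), Finset.image_insert, Finset.range_add_one (n := m),
      Finset.image_insert (s := Finset.range m) (f := fun t => ε (W t) (W (t + 1))),
      ← Finset.range_add_one]
    by_cases hv : W (m + 1) ∈ (Finset.range (m + 1)).image W
    · rw [Finset.insert_eq_of_mem hv]
      exact ih.trans (by gcongr; exact Finset.subset_insert _ _)
    · have hn : ε (W m) (W (m + 1)) ∉ (Finset.range m).image fun t => ε (W t) (W (t + 1)) := by
        intro hmem
        obtain ⟨t, ht, he⟩ := Finset.mem_image.1 hmem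
        have ht' := Finset.mem_range.1 ht
        rcases hε _ _ _ _ he.symm with h | h
        · exact hv (Finset.mem_image.2 ⟨t, Finset.mem_range.2 (by omega), h.symm⟩)
        · exact hv (Finset.mem_image.2 ⟨t + 1, Finset.mem_range.2 (by omega), h.symm⟩)
      rw [Finset.card_insert_of_notMem hv, Finset.card_insert_of_notMem hn]
      omega

theorem card_image_path_le {V T : Type*} [DecidableEq V] [DecidableEq T] (ε : V → V → T)
    (hε : ∀ a b c d, ε a b = ε c d → b = c ∨ b = d) (p : ℕ) (w : Fin (2 * p + 1) → V)
    (h1 : ∀ e, (Finset.univ.filter fun t : Fin (2 * p) => ε (w t.castSucc) (w t.succ) = e).card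
      ≠ 1) : (Finset.univ.image w).card ≤ p + 1 := by
  have hE : 2 * (Finset.univ.image fun t : Fin (2 * p) => ε (w t.castSucc) (w t.succ)).card
      ≤ 2 * p := by
    have := Finset.mul_card_image_le_card (f := fun t : Fin (2 * p) => ε (w t.castSucc) (w t.succ))
      Finset.univ 2 (fun e he => by
        obtain ⟨t, -, ht⟩ := Finset.mem_image.1 he
        have hpos : 0 < (Finset.univ.filter
            fun t : Fin (2 * p) => ε (w t.castSucc) (w t.succ) = e).card :=
          Finset.card_pos.2 ⟨t, by simpa using ht⟩
        have := h1 e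
        omega)
    simpa using this
  set W : ℕ → V := fun t => if h : t < 2 * p + 1 then w ⟨t, h⟩ else w 0 with hW
  have key := card_vertices_le_card_edges_add_one ε hε W (2 * p)
  have hV : (Finset.range (2 * p + 1)).image W = Finset.univ.image w := by
    ext v
    simp only [Finset.mem_image, Finset.mem_range, Finset.mem_univ, true_and]
    constructor
    · rintro ⟨t, ht, rfl⟩
      exact ⟨⟨t, ht⟩, by simp only [hW, dif_pos ht]⟩
    · rintro ⟨t, rfl⟩
      exact ⟨t, t.2, by simp only [hW, dif_pos t.2]⟩
  have hEd : ((Finset.range (2 * p)).image fun t => ε (W t) (W (t + 1)))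
      = Finset.univ.image fun t : Fin (2 * p) => ε (w t.castSucc) (w t.succ) := by
    have hWt : ∀ t (ht : t < 2 * p), ε (W t) (W (t + 1))
        = ε (w (⟨t, ht⟩ : Fin (2 * p)).castSucc) (w (⟨t, ht⟩ : Fin (2 * p)).succ) := by
      intro t ht
      have h2 : t < 2 * p + 1 := by omega
      simp only [hW, h2, dif_pos, Nat.add_lt_add_iff_right, ht]
      rfl
    ext v
    simp only [Finset.mem_image, Finset.mem_range, Finset.mem_univ, true_and]
    constructor
    · rintro ⟨t, ht, rfl⟩
      exact ⟨⟨t, ht⟩, (hWt t ht).symm⟩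
    · rintro ⟨t, rfl⟩
      exact ⟨t, t.2, hWt t t.2⟩
  rw [hV, hEd] at key
  omega

theorem card_filter_image_le {V : Type*} [Fintype V] [DecidableEq V] (m r : ℕ) :
    (Finset.univ.filter fun w : Fin (m + 1) → V => (Finset.univ.image w).card ≤ r).card
      ≤ Fintype.card V ^ r * r ^ (m + 1) := by
  have hsub : (Finset.univ.filter fun w : Fin (m + 1) → V => (Finset.univ.image w).card ≤ r)
      ⊆ Finset.univ.image fun uv : (Fin r → V) × (Fin (m + 1) → Fin r) => uv.1 ∘ uv.2 := by
    intro w hw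
    have hcard : (Finset.univ.image w).card ≤ r := by simpa using hw
    obtain ⟨φ⟩ : Nonempty ({v // v ∈ Finset.univ.image w} ↪ Fin r) :=
      Function.Embedding.nonempty_of_card_le (by
        simpa only [Fintype.card_coe, Fintype.card_fin] using hcard)
    refine Finset.mem_image.2 ⟨(Function.extend φ Subtype.val fun _ => w 0,
      fun t => φ ⟨w t, Finset.mem_image_of_mem _ (Finset.mem_univ t)⟩), Finset.mem_univ _, ?_⟩
    funext t
    simp [φ.injective.extend_apply]
  refine (Finset.card_le_card hsub).trans (Finset.card_image_le.trans ?_)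
  simp

/-! ### Traces of random matrices with independent centered entries -/

/-- The representative `i ≤ j` of an unordered index pair. -/
def sortPair {N : ℕ} (i j : Fin N) : UpperPair N :=
  ⟨(min i j, max i j), min_le_max⟩

theorem sortPair_comm {N : ℕ} (i j : Fin N) : sortPair i j = sortPair j i := by
  simp [sortPair, min_comm, max_comm]

theorem sortPair_of_le {N : ℕ} {i j : Fin N} (h : i ≤ j) : sortPair i j = ⟨(i, j), h⟩ := by
  simp [sortPair, h]

theorem sortPair_eq {N : ℕ} (a b c d : Fin N) (h : sortPair a b = sortPair c d) :
    b = c ∨ b = d := by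
  simp only [sortPair, Subtype.mk.injEq, Prod.mk.injEq] at h
  rcases le_total a b with h1 | h1 <;> rcases le_total c d with h2 | h2 <;>
    simp only [h1, h2, min_eq_left, min_eq_right, max_eq_left, max_eq_right] at h <;> tauto

/-- The symmetric matrix with entries `y e` at the positions of the pair `e`. -/
def symmMatrix {N : ℕ} (y : UpperPair N → ℝ) : Matrix (Fin N) (Fin N) ℝ :=
  Matrix.of fun i j => y (sortPair i j)

theorem symmMatrix_isSymm {N : ℕ} (y : UpperPair N → ℝ) : (symmMatrix y).IsSymm := by
  ext i j
  simp [symmMatrix, sortPair_comm i j]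

theorem abs_prod_le_sum_pow {m : ℕ} (hm : m ≠ 0) (a : Fin m → ℝ) :
    |∏ t, a t| ≤ ∑ t, (m : ℝ)⁻¹ * |a t| ^ m := by
  have hm' : (m : ℝ) ≠ 0 := by exact_mod_cast hm
  have h := Real.geom_mean_le_arith_mean_weighted Finset.univ (fun _ : Fin m => (m : ℝ)⁻¹)
    (fun t => |a t| ^ m) (fun _ _ => by positivity) (by simp [hm']) (fun _ _ => by positivity)
  rw [Finset.abs_prod]
  refine le_trans (le_of_eq ?_) h
  refine Finset.prod_congr rfl fun t _ => ?_
  exact (Real.pow_rpow_inv_natCast (abs_nonneg _) hm).symm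

section PathProducts

variable {E : Type*} [Fintype E] {μ : Measure ℝ} [IsProbabilityMeasure μ]
  {y : E → ℝ → ℝ} {m : ℕ} {B : ℝ}

theorem integrable_comp_eval {h : ℝ → ℝ} (hh : Integrable h μ) (e : E) :
    Integrable (fun z : E → ℝ => h (z e)) (Measure.pi fun _ => μ) :=
  (measurePreserving_eval (fun _ : E => μ) e).integrable_comp_of_integrable hh

theorem integral_comp_eval (h : ℝ → ℝ) (hh : AEStronglyMeasurable h μ) (e : E) :
    ∫ z : E → ℝ, h (z e) ∂(Measure.pi fun _ => μ) = ∫ z, h z ∂μ := by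
  have hmp := measurePreserving_eval (fun _ : E => μ) e
  have hh' : AEStronglyMeasurable h (Measure.map (Function.eval e) (Measure.pi fun _ : E => μ)) :=
    by rwa [hmp.map_eq]
  have := integral_map hmp.aemeasurable hh'
  rw [hmp.map_eq] at this
  exact this.symm

theorem integrable_prod_path (hm : m ≠ 0) (hy : ∀ e, Measurable (y e))
    (hint : ∀ e, Integrable (fun z => |y e z| ^ m) μ) (w : Fin m → E) :
    Integrable (fun z : E → ℝ => ∏ t, y (w t) (z (w t))) (Measure.pi fun _ => μ) := by
  refine Integrable.mono' (g := fun z : E → ℝ => ∑ t, (m : ℝ)⁻¹ * |y (w t) (z (w t))| ^ m)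
    (integrable_finsetSum _ fun t _ =>
      (integrable_comp_eval (hint (w t)) (w t)).const_mul _) ?_
    (ae_of_all _ fun z => abs_prod_le_sum_pow hm _)
  exact (Finset.measurable_fun_prod _ fun t _ =>
    (hy _).comp (measurable_pi_apply _)).aestronglyMeasurable

theorem integral_prod_path_le (hm : m ≠ 0) (hy : ∀ e, Measurable (y e))
    (hint : ∀ e, Integrable (fun z => |y e z| ^ m) μ) (hB : ∀ e, ∫ z, |y e z| ^ m ∂μ ≤ B)
    (w : Fin m → E) :
    ∫ z : E → ℝ, ∏ t, y (w t) (z (w t)) ∂(Measure.pi fun _ => μ) ≤ B := by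
  have hi : ∀ t, Integrable (fun z : E → ℝ => (m : ℝ)⁻¹ * |y (w t) (z (w t))| ^ m)
      (Measure.pi fun _ => μ) := fun t =>
    (integrable_comp_eval (hint (w t)) (w t)).const_mul _
  calc _ ≤ ∫ z : E → ℝ, ∑ t, (m : ℝ)⁻¹ * |y (w t) (z (w t))| ^ m ∂(Measure.pi fun _ => μ) :=
        integral_mono (integrable_prod_path hm hy hint w) (integrable_finsetSum _ fun t _ => hi t)
          fun z => (le_abs_self _).trans (abs_prod_le_sum_pow hm _)
    _ = ∑ t, (m : ℝ)⁻¹ * ∫ z, |y (w t) z| ^ m ∂μ := by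
        rw [integral_finsetSum _ fun t _ => hi t]
        refine Finset.sum_congr rfl fun t _ => ?_
        rw [integral_const_mul,
          integral_comp_eval (fun x => |y (w t) x| ^ m) (hint (w t)).1 (w t)]
    _ ≤ ∑ _t : Fin m, (m : ℝ)⁻¹ * B := by
        gcongr
        exact hB _
    _ = B := by
        have hm' : (m : ℝ) ≠ 0 := by exact_mod_cast hm
        simp [mul_inv_cancel_left₀ hm']

theorem integral_prod_path_eq_zero [DecidableEq E] (hc : ∀ e, ∫ z, y e z ∂μ = 0) (w : Fin m → E)
    (e₀ : E) (he : (Finset.univ.filter fun t => w t = e₀).card = 1) :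
    ∫ z : E → ℝ, ∏ t, y (w t) (z (w t)) ∂(Measure.pi fun _ => μ) = 0 := by
  have h : ∀ z : E → ℝ, ∏ t, y (w t) (z (w t))
      = ∏ e, y e (z e) ^ (Finset.univ.filter fun t => w t = e).card := by
    intro z
    rw [← Finset.prod_fiberwise' Finset.univ w (fun e => y e (z e))]
    simp
  simp only [h]
  rw [integral_fintype_prod_eq_prod
    (fun e x => y e x ^ (Finset.univ.filter fun t => w t = e).card)]
  exact Finset.prod_eq_zero (Finset.mem_univ e₀) (by simp [he, hc])

end PathProducts

/-- Wigner's moment bound: only closed paths without simple edges contribute to the expected trace,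
and these visit at most `p + 1` vertices. -/
theorem integral_trace_pow_le {N p : ℕ} (hp : p ≠ 0) {μ : Measure ℝ} [IsProbabilityMeasure μ]
    {y : UpperPair N → ℝ → ℝ} {B : ℝ} (hB0 : 0 ≤ B) (hy : ∀ e, Measurable (y e))
    (hint : ∀ e, Integrable (fun z => |y e z| ^ (2 * p)) μ)
    (hB : ∀ e, ∫ z, |y e z| ^ (2 * p) ∂μ ≤ B) (hc : ∀ e, ∫ z, y e z ∂μ = 0) :
    Integrable (fun z : UpperPair N → ℝ => (symmMatrix (fun e => y e (z e)) ^ (2 * p)).trace)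
        (Measure.pi fun _ => μ) ∧
      ∫ z : UpperPair N → ℝ, (symmMatrix (fun e => y e (z e)) ^ (2 * p)).trace
        ∂(Measure.pi fun _ => μ)
        ≤ (N : ℝ) ^ (p + 1) * ((p : ℝ) + 1) ^ (2 * p + 1) * B := by
  have hm : 2 * p ≠ 0 := by omega
  have hI : ∀ w : Fin (2 * p + 1) → Fin N, Integrable (fun z : UpperPair N → ℝ =>
      if w (Fin.last (2 * p)) = w 0 then ∏ t : Fin (2 * p),
        y (sortPair (w t.castSucc) (w t.succ)) (z (sortPair (w t.castSucc) (w t.succ))) else 0)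
      (Measure.pi fun _ => μ) := by
    intro w
    split_ifs
    · exact integrable_prod_path hm hy hint fun t => sortPair (w t.castSucc) (w t.succ)
    · exact integrable_zero _ _ _
  simp only [trace_pow_eq_sum_paths, symmMatrix, Matrix.of_apply]
  refine ⟨integrable_finsetSum _ fun w _ => hI w, ?_⟩
  rw [integral_finsetSum _ fun w _ => hI w]
  calc _ ≤ ∑ w : Fin (2 * p + 1) → Fin N,
        if (Finset.univ.image w).card ≤ p + 1 then B else 0 := by
        refine Finset.sum_le_sum fun w _ => ?_
        by_cases hw : w (Fin.last (2 * p)) = w 0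
        · simp only [if_pos hw]
          by_cases hs : ∃ e, (Finset.univ.filter
              fun t : Fin (2 * p) => sortPair (w t.castSucc) (w t.succ) = e).card = 1
          -- An edge passed only once contributes an independent factor of mean zero.
          · obtain ⟨e, he⟩ := hs
            rw [integral_prod_path_eq_zero hc
              (fun t : Fin (2 * p) => sortPair (w t.castSucc) (w t.succ)) e he]
            split_ifs <;> simp [hB0]
          · push Not at hs
            rw [if_pos (card_image_path_le sortPair sortPair_eq p w hs)]
            exact integral_prod_path_le hm hy hint hB
              fun t : Fin (2 * p) => sortPair (w t.castSucc) (w t.succ)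
        · simp only [if_neg hw, integral_zero]
          split_ifs <;> simp [hB0]
    _ = ((Finset.univ.filter
          fun w : Fin (2 * p + 1) → Fin N => (Finset.univ.image w).card ≤ p + 1).card : ℝ)
          * B := by
        rw [← Finset.sum_filter, Finset.sum_const, nsmul_eq_mul]
    _ ≤ _ := by
        gcongr
        have := card_filter_image_le (V := Fin N) (2 * p) (p + 1)
        rw [Fintype.card_fin] at this
        exact_mod_cast this

/-! ### The fluctuating part of the error -/

/-- The signal part `γ N^{-1/2} x_i x_j` of the argument of the non-linearity. -/
noncomputable def shift {N : ℕ} (γ : ℝ) (x : Fin N → ℝ) (i j : Fin N) : ℝ :=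
  γ / √(N : ℝ) * x i * x j

theorem abs_shift_le {N : ℕ} (γ : ℝ) (x : Fin N → ℝ) (i j : Fin N) :
    |shift γ x i j| ≤ |γ| / √(N : ℝ) * ((1 + |x i|) * (1 + |x j|)) := by
  rw [shift, abs_mul, abs_mul, abs_div, abs_of_nonneg (Real.sqrt_nonneg _), mul_assoc]
  gcongr <;> linarith

theorem shift_sortPair {N : ℕ} (γ : ℝ) (x : Fin N → ℝ) (i j : Fin N) :
    shift γ x (sortPair i j).1.1 (sortPair i j).1.2 = shift γ x i j := by
  rcases le_total i j with h | h
  · rw [sortPair_of_le h]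
  · rw [sortPair_comm, sortPair_of_le h]
    simp only [shift]
    ring

theorem measurable_shift {N : ℕ} (γ : ℝ) (i j : Fin N) :
    Measurable fun x : Fin N → ℝ => shift γ x i j := by
  unfold shift
  fun_prop

/-- A term `(1 + |s|) ^ b |s| ^ l` with `s` the signal part of an argument is bounded by powers of
the entries of the signal. -/
theorem one_add_abs_shift_pow_mul_le {N : ℕ} {γ R : ℝ} (hR : |γ| / √(N : ℝ) ≤ R)
    (x : Fin N → ℝ) (i j : Fin N) (b l : ℕ) :
    (1 + |shift γ x i j|) ^ b * |shift γ x i j| ^ l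
      ≤ (1 + R) ^ b * (|γ| / √(N : ℝ)) ^ l * ((1 + |x i|) * (1 + |x j|)) ^ (b + l) := by
  have hr : 0 ≤ |γ| / √(N : ℝ) := by positivity
  have h := abs_shift_le γ x i j
  set Y := (1 + |x i|) * (1 + |x j|) with hY
  have hY1 : 1 ≤ Y := one_le_mul_of_one_le_of_one_le (by linarith [abs_nonneg (x i)])
    (by linarith [abs_nonneg (x j)])
  have h1 : 1 + |shift γ x i j| ≤ (1 + R) * Y := by
    have : |γ| / √(N : ℝ) * Y ≤ R * Y := by gcongr
    linarith
  calc _ ≤ ((1 + R) * Y) ^ b * (|γ| / √(N : ℝ) * Y) ^ l := by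
        have : 0 ≤ (1 + R) * Y := le_trans (by positivity) h1
        gcongr
    _ = _ := by rw [mul_pow _ Y b, mul_pow _ Y l, pow_add Y]; ring

/-- The increment `f (z + s) - f z`, centered for `z ∼ μ`. -/
noncomputable def noise (μ : Measure ℝ) (f : ℝ → ℝ) (s z : ℝ) : ℝ :=
  f (z + s) - f z - (∫ u, f (u + s) ∂μ - ∫ u, f u ∂μ)

/-- The symmetric matrix of the centered increments. -/
noncomputable def noiseMatrix {N : ℕ} (μ : Measure ℝ) (f : ℝ → ℝ) (γ : ℝ) (x : Fin N → ℝ)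
    (z : UpperPair N → ℝ) : Matrix (Fin N) (Fin N) ℝ :=
  symmMatrix fun e => noise μ f (shift γ x e.1.1 e.1.2) (z e)

theorem noiseMatrix_apply {N : ℕ} (μ : Measure ℝ) (f : ℝ → ℝ) (γ : ℝ) (x : Fin N → ℝ)
    (z : UpperPair N → ℝ) (i j : Fin N) :
    noiseMatrix μ f γ x z i j = noise μ f (shift γ x i j) (z (sortPair i j)) := by
  simp [noiseMatrix, symmMatrix, shift_sortPair]

section Noise

variable {μ : Measure ℝ} [IsProbabilityMeasure μ] {f : ℝ → ℝ} {C : ℝ} {β : ℕ}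

theorem measurable_noise (hf : Continuous f) : Measurable fun p : ℝ × ℝ => noise μ f p.1 p.2 := by
  have h1 : Measurable fun s : ℝ => ∫ u, f (u + s) ∂μ :=
    (StronglyMeasurable.integral_prod_right (f := fun s u : ℝ => f (u + s))
      (Continuous.stronglyMeasurable (by
        exact hf.comp (by fun_prop : Continuous fun p : ℝ × ℝ => p.2 + p.1)))).measurable
  unfold noise
  have hfm := hf.measurable
  exact ((hfm.comp (by fun_prop)).sub (hfm.comp measurable_snd)).sub
    ((h1.comp measurable_fst).sub_const _)

theorem integral_noise_eq_zero (hμ : StretchedExpTails μ) (hf : PolyLip C β f) (s : ℝ) :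
    ∫ z, noise μ f s z ∂μ = 0 := by
  unfold noise
  have h1 : Integrable (fun z => f (z + s) - f z) μ :=
    (hf.integrable_comp_add hμ s).sub (hf.integrable hμ)
  rw [integral_sub h1 (integrable_const _),
    integral_sub (hf.integrable_comp_add hμ s) (hf.integrable hμ)]
  simp

theorem abs_noise_le (hμ : StretchedExpTails μ) (hf : PolyLip C β f) (s z : ℝ) :
    |noise μ f s z| ≤ C * (1 + |s|) ^ β * |s| * (1 + ∫ u, (1 + |u|) ^ β ∂μ) * (1 + |z|) ^ β := by
  have hC := hf.nonneg
  have hA : 0 ≤ ∫ u, (1 + |u|) ^ β ∂μ := integral_nonneg fun u => by positivity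
  have h1 := hf.abs_shift_sub_le z s le_rfl
  have h2 : |∫ u, f (u + s) ∂μ - ∫ u, f u ∂μ|
      ≤ C * (1 + |s|) ^ β * |s| * ∫ u, (1 + |u|) ^ β ∂μ := by
    rw [← integral_sub (hf.integrable_comp_add hμ s) (hf.integrable hμ), ← integral_const_mul]
    refine (Real.norm_eq_abs _).symm.le.trans (norm_integral_le_of_norm_le
      ((hμ.integrable_one_add_abs_pow β).const_mul _) (ae_of_all _ fun u => ?_))
    exact (hf.abs_shift_sub_le u s le_rfl).trans (le_of_eq (by ring))
  have h3 : (1 : ℝ) ≤ (1 + |z|) ^ β := one_le_pow₀ (by linarith [abs_nonneg z])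
  have h4 : 0 ≤ C * (1 + |s|) ^ β * |s| * ∫ u, (1 + |u|) ^ β ∂μ := by positivity
  unfold noise
  calc _ ≤ |f (z + s) - f z| + |∫ u, f (u + s) ∂μ - ∫ u, f u ∂μ| := abs_sub _ _
    _ ≤ C * (1 + |s|) ^ β * (1 + |z|) ^ β * |s|
        + C * (1 + |s|) ^ β * |s| * (∫ u, (1 + |u|) ^ β ∂μ) * (1 + |z|) ^ β := by
        gcongr
        exact h2.trans (le_mul_of_one_le_right h4 h3)
    _ = _ := by ring

theorem exists_integral_abs_noise_pow_le (hμ : StretchedExpTails μ) (hf : PolyLip C β f) (m : ℕ) :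
    ∃ K, 0 ≤ K ∧ ∀ s, Integrable (fun z => |noise μ f s z| ^ m) μ ∧
      ∫ z, |noise μ f s z| ^ m ∂μ ≤ K * ((1 + |s|) ^ β * |s|) ^ m := by
  have hC := hf.nonneg
  have hA : 0 ≤ ∫ u, (1 + |u|) ^ β ∂μ := integral_nonneg fun u => by positivity
  have hM : 0 ≤ ∫ z, (1 + |z|) ^ (β * m) ∂μ := integral_nonneg fun u => by positivity
  refine ⟨(C * (1 + ∫ u, (1 + |u|) ^ β ∂μ)) ^ m * ∫ z, (1 + |z|) ^ (β * m) ∂μ, by positivity,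
    fun s => ?_⟩
  have hb : ∀ z, |noise μ f s z| ^ m
      ≤ (C * (1 + |s|) ^ β * |s| * (1 + ∫ u, (1 + |u|) ^ β ∂μ)) ^ m * (1 + |z|) ^ (β * m) := by
    intro z
    rw [pow_mul, ← mul_pow]
    gcongr
    exact abs_noise_le hμ hf s z
  have hi : Integrable (fun z => |noise μ f s z| ^ m) μ := by
    refine Integrable.mono' ((hμ.integrable_one_add_abs_pow (β * m)).const_mul
      ((C * (1 + |s|) ^ β * |s| * (1 + ∫ u, (1 + |u|) ^ β ∂μ)) ^ m)) ?_
      (ae_of_all _ fun z => ?_)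
    · exact (((measurable_noise hf.continuous).comp
        (measurable_const.prodMk measurable_id)).abs.pow_const m).aestronglyMeasurable
    · rw [Real.norm_of_nonneg (by positivity)]
      exact hb z
  refine ⟨hi, ?_⟩
  refine (integral_mono hi ((hμ.integrable_one_add_abs_pow (β * m)).const_mul _) hb).trans
    (le_of_eq ?_)
  rw [integral_const_mul, mul_pow, mul_pow, mul_pow, mul_pow, mul_pow]
  ring

theorem mul_pow_le_sum {N : ℕ} (x : Fin N → ℝ) (i j : Fin N) (a : ℕ) :
    ((1 + |x i|) * (1 + |x j|)) ^ a ≤ ∑ l, (1 + |x l|) ^ (2 * a) := by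
  have h := fun i => Finset.single_le_sum (f := fun l => (1 + |x l|) ^ (2 * a))
    (fun l _ => by positivity) (Finset.mem_univ i)
  have hi := h i
  have hj := h j
  simp only [mul_comm 2 a, pow_mul] at hi hj ⊢
  rw [mul_pow]
  nlinarith [sq_nonneg ((1 + |x i|) ^ a - (1 + |x j|) ^ a)]

theorem integral_sum_one_add_abs_pow {π : Measure ℝ} [IsProbabilityMeasure π]
    (hπ : StretchedExpTails π) (N a : ℕ) :
    Integrable (fun x : Fin N → ℝ => ∑ l, (1 + |x l|) ^ a) (Measure.pi fun _ => π) ∧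
      ∫ x : Fin N → ℝ, ∑ l, (1 + |x l|) ^ a ∂(Measure.pi fun _ => π)
        = N * ∫ u, (1 + |u|) ^ a ∂π := by
  have hi : ∀ l, Integrable (fun x : Fin N → ℝ => (1 + |x l|) ^ a) (Measure.pi fun _ => π) :=
    fun l => integrable_comp_eval (hπ.integrable_one_add_abs_pow a) l
  refine ⟨integrable_finsetSum _ fun l _ => hi l, ?_⟩
  rw [integral_finsetSum _ fun l _ => hi l]
  have : ∀ l : Fin N, ∫ x : Fin N → ℝ, (1 + |x l|) ^ a ∂(Measure.pi fun _ => π)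
      = ∫ u, (1 + |u|) ^ a ∂π := fun l =>
    integral_comp_eval (fun u => (1 + |u|) ^ a) (hπ.integrable_one_add_abs_pow a).1 l
  simp [this]

theorem measurable_trace_noiseMatrix_pow (hf : Continuous f) (N : ℕ) (γ : ℝ) (m : ℕ) :
    Measurable fun ω : (Fin N → ℝ) × (UpperPair N → ℝ) =>
      (noiseMatrix μ f γ ω.1 ω.2 ^ m).trace := by
  simp only [trace_pow_eq_sum_paths, noiseMatrix_apply]
  refine Finset.measurable_fun_sum _ fun w _ => ?_
  split_ifs
  · refine Finset.measurable_fun_prod _ fun t _ => ?_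
    exact (measurable_noise hf).comp
      (((measurable_shift γ _ _).comp measurable_fst).prodMk
        ((measurable_pi_apply _).comp measurable_snd))
  · exact measurable_const

/-- Expected trace of the powers of the noise matrix, with respect to signal and noise. -/
theorem exists_lintegral_trace_noise_le {π : Measure ℝ} [IsProbabilityMeasure π]
    (hπ : StretchedExpTails π) (hμ : StretchedExpTails μ) (hf : PolyLip C β f) {R : ℝ} (q : ℕ) :
    ∃ K, 0 ≤ K ∧ ∀ (N : ℕ) (γ : ℝ), |γ| / √(N : ℝ) ≤ R →
      ∫⁻ ω, ENNReal.ofReal (noiseMatrix μ f γ ω.1 ω.2 ^ (2 * 2 ^ q)).trace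
        ∂((Measure.pi fun _ : Fin N => π).prod (Measure.pi fun _ : UpperPair N => μ))
        ≤ ENNReal.ofReal (K * (N : ℝ) ^ (2 ^ q + 2) * (|γ| / √(N : ℝ)) ^ (2 * 2 ^ q)) := by
  obtain ⟨K, hK, H⟩ := exists_integral_abs_noise_pow_le hμ hf (2 * 2 ^ q)
  have hp : 2 ^ q ≠ 0 := by positivity
  set p := 2 ^ q with hpdef
  set a := 2 * ((β + 1) * (2 * p)) with ha
  have hM : 0 ≤ ∫ u, (1 + |u|) ^ a ∂π := integral_nonneg fun u => by positivity
  have hR2 : 0 ≤ (1 + R) ^ (β * (2 * p)) := by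
    rw [mul_left_comm, pow_mul, pow_mul]; positivity
  refine ⟨((p : ℝ) + 1) ^ (2 * p + 1) * (K * (1 + R) ^ (β * (2 * p)))
    * ∫ u, (1 + |u|) ^ a ∂π, by positivity, fun N γ hR => ?_⟩
  set r := |γ| / √(N : ℝ) with hr
  have hr0 : 0 ≤ r := by positivity
  have hmeas := measurable_trace_noiseMatrix_pow (μ := μ) hf.continuous N γ (2 * p)
  rw [lintegral_prod _ hmeas.ennreal_ofReal.aemeasurable]
  have hB : ∀ (x : Fin N → ℝ) (e : UpperPair N),
      ∫ z, |noise μ f (shift γ x e.1.1 e.1.2) z| ^ (2 * p) ∂μ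
        ≤ K * (1 + R) ^ (β * (2 * p)) * r ^ (2 * p) * ∑ l, (1 + |x l|) ^ a := by
    intro x e
    refine (H _).2.trans ?_
    have h1 := one_add_abs_shift_pow_mul_le hR x e.1.1 e.1.2 β 1
    rw [pow_one, pow_one] at h1
    calc _ ≤ K * ((1 + R) ^ β * r * ((1 + |x e.1.1|) * (1 + |x e.1.2|)) ^ (β + 1))
          ^ (2 * p) := by gcongr
      _ = K * (1 + R) ^ (β * (2 * p)) * r ^ (2 * p)
          * ((1 + |x e.1.1|) * (1 + |x e.1.2|)) ^ ((β + 1) * (2 * p)) := by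
          rw [mul_pow, mul_pow, ← pow_mul, ← pow_mul]
          ring
      _ ≤ _ := by
          gcongr
          exact mul_pow_le_sum x _ _ _
  have hin : ∀ x : Fin N → ℝ,
      ∫⁻ z, ENNReal.ofReal (noiseMatrix μ f γ x z ^ (2 * p)).trace
        ∂(Measure.pi fun _ : UpperPair N => μ)
        ≤ ENNReal.ofReal ((N : ℝ) ^ (p + 1) * ((p : ℝ) + 1) ^ (2 * p + 1)
          * (K * (1 + R) ^ (β * (2 * p)) * r ^ (2 * p) * ∑ l, (1 + |x l|) ^ a)) := by
    intro x
    have ht := integral_trace_pow_le hp (μ := μ)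
      (y := fun e => noise μ f (shift γ x e.1.1 e.1.2)) (by positivity)
      (fun e => (measurable_noise hf.continuous).comp (measurable_const.prodMk measurable_id))
      (fun e => (H _).1) (hB x) (fun e => integral_noise_eq_zero hμ hf _)
    have hnn : ∀ z : UpperPair N → ℝ, 0 ≤ (noiseMatrix μ f γ x z ^ (2 * p)).trace := fun z =>
      le_trans (pow_nonneg (opNorm_nonneg _) _) (opNorm_pow_le_trace (symmMatrix_isSymm _) q)
    rw [← ofReal_integral_eq_lintegral_ofReal
      (f := fun z => (noiseMatrix μ f γ x z ^ (2 * p)).trace) ht.1 (ae_of_all _ hnn)]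
    exact ENNReal.ofReal_le_ofReal ht.2
  refine (lintegral_mono hin).trans ?_
  have hs := integral_sum_one_add_abs_pow hπ N a
  rw [← ofReal_integral_eq_lintegral_ofReal ((hs.1.const_mul _).const_mul _)
    (ae_of_all _ fun x => by positivity)]
  refine ENNReal.ofReal_le_ofReal (le_of_eq ?_)
  rw [integral_const_mul, integral_const_mul, hs.2]
  ring

/-- The scale of the signal parts stays bounded. -/
theorem abs_div_sqrt_le {N k : ℕ} {γ G : ℝ} (hG : (|γ| / √(N : ℝ)) ^ (k + 1) * √(N : ℝ) ≤ G)
    (hN : 1 ≤ N) : |γ| / √(N : ℝ) ≤ 1 + G := by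
  have hsq : 1 ≤ √(N : ℝ) := Real.one_le_sqrt.2 (by exact_mod_cast hN)
  set r := |γ| / √(N : ℝ)
  have hr0 : 0 ≤ r := by positivity
  have hG0 : 0 ≤ G := le_trans (by positivity) hG
  by_contra! hlt
  have h1 : r ≤ r ^ (k + 1) := le_self_pow₀ (by linarith) (by omega)
  have h2 : r ^ (k + 1) ≤ r ^ (k + 1) * √(N : ℝ) := le_mul_of_one_le_right (by positivity) hsq
  linarith

/-- The noise matrix is small with high probability. The high moment compensates the slow decay
`N ^ (-1 / (2 (k + 1)))` of the scale of its entries. -/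
theorem exists_noise_prob_le {π : Measure ℝ} [IsProbabilityMeasure π]
    (hπ : StretchedExpTails π) (hμ : StretchedExpTails μ) (hf : PolyLip C β f) {k : ℕ} {γ : ℕ → ℝ}
    {G : ℝ} (hG : ∀ N : ℕ, 1 ≤ N → (|γ N| / √(N : ℝ)) ^ (k + 1) * √(N : ℝ) ≤ G) {ε : ℝ}
    (hε : 0 < ε) :
    ∃ K, 0 ≤ K ∧ ∀ N : ℕ, 1 ≤ N →
      ((Measure.pi fun _ : Fin N => π).prod (Measure.pi fun _ : UpperPair N => μ)).real
        {ω | ε < opNorm ((1 / √(N : ℝ)) • noiseMatrix μ f (γ N) ω.1 ω.2)} ≤ K / N := by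
  have hG0 : 0 ≤ G := le_trans (by positivity) (hG 1 le_rfl)
  have hr := fun (N : ℕ) (hN : 1 ≤ N) => abs_div_sqrt_le (hG N hN) hN
  -- With `r = |γ| / √N`, the expected trace contributes `N ^ 2 * r ^ (2 p)` to the probability.
  -- Since `r ^ (k + 1) ≤ G / √N`, the power `r ^ (6 (k + 1))` supplies the factor `N ^ (-3)`, and
  -- `p = 2 ^ q ≥ 3 (k + 1)` makes it available.
  set q := 3 * (k + 1) with hq
  obtain ⟨K, hK, H⟩ := exists_lintegral_trace_noise_le hπ hμ hf (R := 1 + G) q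
  set p := 2 ^ q with hp
  have hqp : q ≤ p := Nat.lt_two_pow_self.le
  refine ⟨K * (G ^ 6 * (1 + G) ^ (2 * p - 2 * q)) / ε ^ (2 * p), by positivity, fun N hN => ?_⟩
  have hN0 : (0 : ℝ) < N := by exact_mod_cast hN
  have hsq : 0 < √(N : ℝ) := Real.sqrt_pos.2 hN0
  have hsq2 : √(N : ℝ) ^ 2 = N := Real.sq_sqrt hN0.le
  have hscale : (|γ N| / √(N : ℝ)) ^ (2 * p) * (N : ℝ) ^ 3
      ≤ G ^ 6 * (1 + G) ^ (2 * p - 2 * q) := by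
    have e : (|γ N| / √(N : ℝ)) ^ (2 * p) * (N : ℝ) ^ 3
        = ((|γ N| / √(N : ℝ)) ^ (k + 1) * √(N : ℝ)) ^ 6
          * (|γ N| / √(N : ℝ)) ^ (2 * p - 2 * q) := by
      have e1 : (N : ℝ) ^ 3 = √(N : ℝ) ^ 6 := by
        rw [show 6 = 2 * 3 by norm_num, pow_mul, hsq2]
      rw [e1, mul_pow, ← pow_mul, show (k + 1) * 6 = 2 * q by omega]
      rw [mul_right_comm, ← pow_add, show 2 * q + (2 * p - 2 * q) = 2 * p by omega]
    rw [e]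
    gcongr
    · exact hG N hN
    · exact hr N hN
  have hsub : {ω : (Fin N → ℝ) × (UpperPair N → ℝ) |
      ε < opNorm ((1 / √(N : ℝ)) • noiseMatrix μ f (γ N) ω.1 ω.2)}
      ⊆ {ω | ENNReal.ofReal ((ε * √(N : ℝ)) ^ (2 * p))
        ≤ ENNReal.ofReal (noiseMatrix μ f (γ N) ω.1 ω.2 ^ (2 * p)).trace} := by
    intro ω hω
    simp only [Set.mem_ofPred_eq] at hω ⊢
    rw [opNorm_smul, abs_of_pos (by positivity), one_div, inv_mul_eq_div, lt_div_iff₀ hsq] at hω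
    refine ENNReal.ofReal_le_ofReal ?_
    refine le_trans ?_ (opNorm_pow_le_trace (symmMatrix_isSymm _) q)
    exact pow_le_pow_left₀ (by positivity) hω.le _
  have hpos : 0 < (ε * √(N : ℝ)) ^ (2 * p) := by positivity
  have hmk := (measure_mono (μ := (Measure.pi fun _ : Fin N => π).prod
    (Measure.pi fun _ : UpperPair N => μ)) hsub).trans (meas_ge_le_lintegral_div
    (measurable_trace_noiseMatrix_pow (μ := μ) hf.continuous N (γ N)
      (2 * p)).ennreal_ofReal.aemeasurable
    (by simpa using hpos) ENNReal.ofReal_ne_top)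
  have hfin := hmk.trans (ENNReal.div_le_div_right (H N (γ N) (hr N hN)) _)
  rw [← ENNReal.ofReal_div_of_pos hpos] at hfin
  refine (ENNReal.toReal_le_of_le_ofReal (by positivity) hfin).trans ?_
  rw [div_le_div_iff₀ hpos hN0, mul_pow, pow_mul (√(N : ℝ)), hsq2]
  calc K * (N : ℝ) ^ (p + 2) * (|γ N| / √(N : ℝ)) ^ (2 * p) * N
      = K * ((|γ N| / √(N : ℝ)) ^ (2 * p) * (N : ℝ) ^ 3) * (N : ℝ) ^ p := by ring
    _ ≤ K * (G ^ 6 * (1 + G) ^ (2 * p - 2 * q)) * (N : ℝ) ^ p := by gcongr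
    _ = _ := by field_simp

end Noise

/-! ### The deterministic part of the error -/

theorem variance_comp_eval {E : Type*} [Fintype E] {μ : Measure ℝ} [IsProbabilityMeasure μ]
    {h : ℝ → ℝ} (hh : AEMeasurable h μ) (e : E) :
    variance (fun z : E → ℝ => h (z e)) (Measure.pi fun _ => μ) = variance h μ :=
  (measurePreserving_eval (fun _ : E => μ) e).variance_fun_comp hh

/-- Chebyshev's inequality for the empirical moments of the signal. -/
theorem exists_prob_empirical_moment_le {π : Measure ℝ} [IsProbabilityMeasure π]
    (hπ : StretchedExpTails π) (a : ℕ) :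
    ∃ T V, 0 ≤ V ∧ 0 ≤ T ∧ ∀ N : ℕ, 1 ≤ N → (Measure.pi fun _ : Fin N => π).real
      {x | T * N < ∑ l, (1 + |x l|) ^ a} ≤ V / N := by
  have hM : 0 ≤ ∫ u, (1 + |u|) ^ a ∂π := integral_nonneg fun u => by positivity
  refine ⟨(∫ u, (1 + |u|) ^ a ∂π) + 1, variance (fun u => (1 + |u|) ^ a) π, variance_nonneg _ _,
    by positivity, fun N hN => ?_⟩
  have hN0 : (0 : ℝ) < N := by exact_mod_cast hN
  set P := Measure.pi fun _ : Fin N => π with hP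
  set X : Fin N → (Fin N → ℝ) → ℝ := fun l x => (1 + |x l|) ^ a with hX
  have h2 : ∀ l, MemLp (X l) 2 P := fun l =>
    (by exact_mod_cast hπ.memLp_one_add_abs_pow a 2 :
      MemLp (fun u : ℝ => (1 + |u|) ^ a) 2 π).comp_measurePreserving
      (measurePreserving_eval (fun _ : Fin N => π) l)
  have hind : iIndepFun X P :=
    iIndepFun_pi (X := fun (_ : Fin N) (u : ℝ) => (1 + |u|) ^ a) fun _ => by fun_prop
  have hvar1 : ∀ l, variance (X l) P = variance (fun u => (1 + |u|) ^ a) π := fun l =>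
    variance_comp_eval (hπ.integrable_one_add_abs_pow a).aestronglyMeasurable.aemeasurable l
  have hvar : variance (∑ l, X l) P = N * variance (fun u => (1 + |u|) ^ a) π := by
    rw [IndepFun.variance_sum (fun l _ => h2 l) fun i _ j _ hij => hind.indepFun hij]
    simp [hvar1]
  have hmean : ∫ x, (∑ l, X l) x ∂P = N * ∫ u, (1 + |u|) ^ a ∂π := by
    simpa [hX] using (integral_sum_one_add_abs_pow hπ N a).2
  have hch := meas_ge_le_variance_div_sq (memLp_finsetSum' _ fun l _ => h2 l) hN0
    (X := ∑ l, X l) (μ := P)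
  rw [hvar, hmean] at hch
  have hsub : {x : Fin N → ℝ | ((∫ u, (1 + |u|) ^ a ∂π) + 1) * N < ∑ l, (1 + |x l|) ^ a}
      ⊆ {x | (N : ℝ) ≤ |(∑ l, X l) x - N * ∫ u, (1 + |u|) ^ a ∂π|} := by
    intro x hx
    simp only [Set.mem_ofPred_eq, Finset.sum_apply, hX] at hx ⊢
    refine le_trans ?_ (le_abs_self _)
    linarith
  refine (ENNReal.toReal_le_of_le_ofReal (div_nonneg (mul_nonneg hN0.le (variance_nonneg _ _))
    (by positivity)) ((measure_mono hsub).trans hch)).trans (le_of_eq ?_)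
  field_simp

/-- A matrix of functions of the signal parts that vanish to the order `k + 1` at the origin has
small operator norm, by comparison with the Frobenius norm. -/
theorem opNorm_bias_le {N : ℕ} (hN : 1 ≤ N) {φ : ℝ → ℝ} {K : ℝ} {b k : ℕ} (hK : 0 ≤ K)
    (hφ : ∀ s, |φ s| ≤ K * (1 + |s|) ^ b * |s| ^ (k + 1)) {γ R : ℝ} (hR : |γ| / √(N : ℝ) ≤ R)
    (x : Fin N → ℝ) :
    opNorm (Matrix.of fun i j => 1 / √(N : ℝ) * φ (shift γ x i j))
      ≤ K * (1 + R) ^ b * ((|γ| / √(N : ℝ)) ^ (k + 1) * √(N : ℝ))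
        * ((∑ l, (1 + |x l|) ^ (2 * (b + (k + 1)))) / N) := by
  have hN0 : (0 : ℝ) < N := by exact_mod_cast hN
  have hsq : 0 < √(N : ℝ) := Real.sqrt_pos.2 hN0
  have hsq2 : √(N : ℝ) ^ 2 = N := Real.sq_sqrt hN0.le
  have hR0 : 0 ≤ R := le_trans (by positivity) hR
  set r := |γ| / √(N : ℝ) with hr
  have hr0 : 0 ≤ r := by positivity
  set c := b + (k + 1) with hc
  have hent : ∀ i j, |1 / √(N : ℝ) * φ (shift γ x i j)|
      ≤ 1 / √(N : ℝ) * (K * ((1 + R) ^ b * r ^ (k + 1)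
        * ((1 + |x i|) * (1 + |x j|)) ^ c)) := by
    intro i j
    rw [abs_mul, abs_of_pos (by positivity : 0 < 1 / √(N : ℝ))]
    gcongr
    refine (hφ _).trans ?_
    rw [mul_assoc]
    exact mul_le_mul_of_nonneg_left (one_add_abs_shift_pow_mul_le hR x i j b (k + 1)) hK
  refine abs_le_of_sq_le_sq' ?_ (by positivity) |>.2
  refine (opNorm_sq_le_sum_sq _).trans ?_
  calc _ ≤ ∑ i, ∑ j, (1 / √(N : ℝ) * (K * ((1 + R) ^ b * r ^ (k + 1)
        * ((1 + |x i|) * (1 + |x j|)) ^ c))) ^ 2 := by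
        refine Finset.sum_le_sum fun i _ => Finset.sum_le_sum fun j _ => ?_
        rw [Matrix.of_apply]
        exact sq_le_sq' (abs_le.1 (hent i j)).1 (abs_le.1 (hent i j)).2
    _ = (1 / √(N : ℝ) * (K * ((1 + R) ^ b * r ^ (k + 1)))) ^ 2
        * (∑ l, (1 + |x l|) ^ (2 * c)) ^ 2 := by
        rw [sq (∑ l, (1 + |x l|) ^ (2 * c)), Finset.sum_mul_sum, Finset.mul_sum]
        refine Finset.sum_congr rfl fun i _ => ?_
        rw [Finset.mul_sum]
        refine Finset.sum_congr rfl fun j _ => ?_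
        rw [mul_pow (1 + |x i|)]
        ring
    _ = _ := by
        rw [← mul_pow]
        congr 1
        have : (1 : ℝ) / √(N : ℝ) = √(N : ℝ) / N := by
          rw [div_eq_div_iff hsq.ne' hN0.ne', one_mul, ← sq, hsq2]
        rw [this]
        ring

/-! ### The canonical probability space and the decomposition -/

/-- The joint law of the signal and of the entries `i ≤ j` of the noise. -/
noncomputable def modelLaw (π μ : Measure ℝ) (N : ℕ) :
    Measure ((Fin N → ℝ) × (UpperPair N → ℝ)) :=
  (Measure.pi fun _ => π).prod (Measure.pi fun _ => μ)

instance isProbabilityMeasure_modelLaw (π μ : Measure ℝ) [IsProbabilityMeasure π]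
    [IsProbabilityMeasure μ] (N : ℕ) : IsProbabilityMeasure (modelLaw π μ N) := by
  unfold modelLaw
  infer_instance

theorem symmMatrix_upper {N : ℕ} {A : Matrix (Fin N) (Fin N) ℝ} (hA : A.IsSymm) :
    symmMatrix (fun e => A e.1.1 e.1.2) = A := by
  ext i j
  rcases le_total i j with h | h
  · simp [symmMatrix, sortPair_of_le h]
  · rw [← hA.apply i j]
    simp [symmMatrix, sortPair_comm i j, sortPair_of_le h]

theorem symmMatrix_apply_upper {N : ℕ} (y : UpperPair N → ℝ) (e : UpperPair N) :
    symmMatrix y e.1.1 e.1.2 = y e := by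
  simp [symmMatrix, sortPair_of_le e.2]

/-- Signal and noise of the model have the law `modelLaw`, whichever space they live on. -/
theorem identDistrib_signal_noise {Ω : Type*} [MeasurableSpace Ω] {P : Measure Ω}
    [IsProbabilityMeasure P] {π μ : Measure ℝ} [IsProbabilityMeasure π] [IsProbabilityMeasure μ]
    {N : ℕ} {x : Ω → Fin N → ℝ} {Z : Ω → Matrix (Fin N) (Fin N) ℝ}
    (hx : IsIID (fun i ω => x ω i) π P) (hZ : IsSymmIID Z μ P)
    (hxZ : IndepFun x (fun ω i j => Z ω i j) P) :
    IdentDistrib (fun ω => (x ω, fun e : UpperPair N => Z ω e.1.1 e.1.2)) id P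
      (modelLaw π μ N) := by
  have hxm : AEMeasurable x P := aemeasurable_pi_lambda _ fun i => (hx.hasLaw i).aemeasurable
  have hzm : AEMeasurable (fun ω (e : UpperPair N) => Z ω e.1.1 e.1.2) P :=
    aemeasurable_pi_lambda _ fun e => (hZ.iid.hasLaw e).aemeasurable
  refine ⟨hxm.prodMk hzm, aemeasurable_id, ?_⟩
  have hind : IndepFun x (fun ω (e : UpperPair N) => Z ω e.1.1 e.1.2) P :=
    hxZ.comp (φ := id) (ψ := fun (A : Fin N → Fin N → ℝ) (e : UpperPair N) => A e.1.1 e.1.2)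
      measurable_id (by fun_prop)
  have h1 : P.map x = Measure.pi fun _ => π := by
    have := (iIndepFun_iff_map_fun_eq_pi_map fun i => (hx.hasLaw i).aemeasurable).1 hx.indep
    rw [show (fun i => P.map fun ω => x ω i) = fun _ => π from
      funext fun i => (hx.hasLaw i).map_eq] at this
    exact this
  have h2 : P.map (fun ω (e : UpperPair N) => Z ω e.1.1 e.1.2) = Measure.pi fun _ => μ := by
    have := (iIndepFun_iff_map_fun_eq_pi_map fun e => (hZ.iid.hasLaw e).aemeasurable).1
      hZ.iid.indep
    rw [show (fun e : UpperPair N => P.map fun ω => Z ω e.1.1 e.1.2) = fun _ => μ from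
      funext fun e => (hZ.iid.hasLaw e).map_eq] at this
    exact this
  rw [(indepFun_iff_map_prod_eq_prod_map_map hxm hzm).1 hind, h1, h2, Measure.map_id]
  rfl

/-- The Wigner part of the model: the standardized non-linearity applied to the pure noise. -/
noncomputable def wignerMatrix {N : ℕ} (f : ℝ → ℝ) (m σ : ℝ) (z : UpperPair N → ℝ) :
    Matrix (Fin N) (Fin N) ℝ :=
  symmMatrix fun e => 1 / √(N : ℝ) * ((f (z e) - m) / σ)

theorem measurable_wignerMatrix {N : ℕ} {f : ℝ → ℝ} (hf : Measurable f) (m σ : ℝ) (i j : Fin N) :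
    Measurable fun z : UpperPair N → ℝ => wignerMatrix f m σ z i j := by
  simp only [wignerMatrix, symmMatrix, Matrix.of_apply]
  exact (((hf.comp (measurable_pi_apply _)).sub_const m).div_const σ).const_mul _

theorem isNormalizedWigner_wignerMatrix {π μ : Measure ℝ} [IsProbabilityMeasure π]
    [IsProbabilityMeasure μ] {f : ℝ → ℝ} (hf : Measurable f) (hf4 : MemLp f 4 μ) {σ : ℝ}
    (hσ : 0 < σ) (hvar : σ ^ 2 = ∫ z, f z ^ 2 ∂μ - (∫ z, f z ∂μ) ^ 2) :
    IsNormalizedWigner (Ω := fun N => (Fin N → ℝ) × (UpperPair N → ℝ))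
      (fun _ ω => wignerMatrix f (∫ z, f z ∂μ) σ ω.2) (modelLaw π μ) := by
  set m := ∫ z, f z ∂μ with hm
  set h : ℝ → ℝ := fun z => (f z - m) / σ with hh
  have hhm : Measurable h := (hf.sub_const m).div_const σ
  have h4 : MemLp h 4 μ := by
    have := (hf4.sub (memLp_const m)).const_mul σ⁻¹
    refine this.ae_eq (ae_of_all _ fun z => ?_)
    simp [hh, div_eq_inv_mul]
  have hfi : Integrable f μ := hf4.integrable (by norm_num)
  have hf2 : Integrable (fun z => f z ^ 2) μ :=
    (hf4.mono_exponent (p := 2) (by norm_num)).integrable_sq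
  refine ⟨μ.map h, Measure.isProbabilityMeasure_map hhm.aemeasurable, ?_, ?_, ?_, fun N => ?_⟩
  · rw [memLp_map_measure_iff aestronglyMeasurable_id hhm.aemeasurable]
    exact h4
  · rw [integral_map hhm.aemeasurable (by fun_prop)]
    simp only [hh]
    rw [integral_div, integral_sub hfi (integrable_const _)]
    simp [hm]
  · rw [integral_map hhm.aemeasurable (by fun_prop)]
    have e : ∀ z, h z ^ 2 = (σ ^ 2)⁻¹ * (f z ^ 2 - 2 * m * f z + m ^ 2) := fun z => by
      simp only [hh]
      field_simp
      ring
    simp only [e]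
    have hi : Integrable (fun z => f z ^ 2 - 2 * m * f z) μ := hf2.sub (hfi.const_mul _)
    rw [integral_const_mul, integral_add hi (integrable_const _),
      integral_sub hf2 (hfi.const_mul _), integral_const_mul, ← hm]
    have : σ ^ 2 ≠ 0 := by positivity
    rw [inv_mul_eq_iff_eq_mul₀ this, hvar]
    simp
    ring
  · have hentry : ∀ (p : UpperPair N) (ω : (Fin N → ℝ) × (UpperPair N → ℝ)),
        (√(N : ℝ) • wignerMatrix f m σ ω.2) p.1.1 p.1.2 = h (ω.2 p) := by
      intro p ω
      have hN : √(N : ℝ) ≠ 0 := by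
        have : 0 < N := Fin.pos p.1.1
        positivity
      rw [Matrix.smul_apply, wignerMatrix, symmMatrix_apply_upper, smul_eq_mul, ← mul_assoc,
        mul_one_div_cancel hN, one_mul]
    refine ⟨fun ω => ?_, ?_, ?_⟩
    · exact (symmMatrix_isSymm _).smul _
    · intro p
      simp only [hentry]
      have hmp : MeasurePreserving (fun ω : (Fin N → ℝ) × (UpperPair N → ℝ) => ω.2 p)
          (modelLaw π μ N) μ :=
        (measurePreserving_eval (fun _ : UpperPair N => μ) p).comp measurePreserving_snd
      refine ⟨(hhm.comp hmp.measurable).aemeasurable, ?_⟩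
      rw [← hmp.map_eq, Measure.map_map hhm hmp.measurable, hmp.map_eq]
      rfl
    · simp only [hentry]
      have hbase : iIndepFun (fun (p : UpperPair N) (ω : (Fin N → ℝ) × (UpperPair N → ℝ)) => ω.2 p)
          (modelLaw π μ N) := by
        rw [iIndepFun_iff_map_fun_eq_pi_map fun p => by fun_prop]
        have hmp : ∀ p : UpperPair N,
            MeasurePreserving (fun ω : (Fin N → ℝ) × (UpperPair N → ℝ) => ω.2 p)
              (modelLaw π μ N) μ := fun p =>
          (measurePreserving_eval (fun _ : UpperPair N => μ) p).comp measurePreserving_snd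
        simp only [(hmp _).map_eq]
        exact (measurePreserving_snd (μ := Measure.pi fun _ : Fin N => π)
          (ν := Measure.pi fun _ : UpperPair N => μ)).map_eq
      exact hbase.comp (fun _ => h) fun _ => hhm

theorem modelMatrix_apply_symmMatrix {N : ℕ} (μ : Measure ℝ) (f : ℝ → ℝ) (γ : ℝ) (x : Fin N → ℝ)
    (z : UpperPair N → ℝ) (i j : Fin N) :
    modelMatrix μ f γ x (symmMatrix z) i j
      = 1 / √(N : ℝ) * (f (z (sortPair i j) + shift γ x i j) - ∫ z, f z ∂μ) := rfl

theorem measurable_modelMatrix {N : ℕ} (μ : Measure ℝ) {f : ℝ → ℝ} (hf : Measurable f) (γ : ℝ)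
    (i j : Fin N) : Measurable fun ω : (Fin N → ℝ) × (UpperPair N → ℝ) =>
      modelMatrix μ f γ ω.1 (symmMatrix ω.2) i j := by
  simp only [modelMatrix_apply_symmMatrix]
  refine ((hf.comp ?_).sub_const _).const_mul _
  exact ((measurable_pi_apply _).comp measurable_snd).add
    ((measurable_shift γ i j).comp measurable_fst)

theorem modelMatrix_isSymm {N : ℕ} (μ : Measure ℝ) (f : ℝ → ℝ) (γ : ℝ) (x : Fin N → ℝ)
    (z : UpperPair N → ℝ) : (modelMatrix μ f γ x (symmMatrix z)).IsSymm := by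
  ext i j
  simp only [Matrix.transpose_apply, modelMatrix_apply_symmMatrix]
  rw [sortPair_comm, shift, shift, mul_right_comm]

theorem spikeMatrix_isSymm {N : ℕ} (k : ℕ) (θ γ : ℝ) (x : Fin N → ℝ) :
    (spikeMatrix k θ γ x).IsSymm := by
  ext i j
  simp [spikeMatrix, Matrix.vecMulVec_apply, mul_comm]

/-- The spike consists of the leading Taylor terms of the shifted means. -/
theorem spikeMatrix_apply {N : ℕ} (hN : 1 ≤ N) (k : ℕ) (θ γ : ℝ) (x : Fin N → ℝ) (i j : Fin N) :
    spikeMatrix k θ γ x i j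
      = 1 / √(N : ℝ) * (θ * shift γ x i j ^ k / (k.factorial : ℝ)) := by
  have hN0 : (0 : ℝ) < N := by exact_mod_cast hN
  have hs : 0 < √(N : ℝ) := Real.sqrt_pos.2 hN0
  have h1 : (N : ℝ) ^ ((k : ℝ) / 2 - 1 / 2) = √(N : ℝ) ^ k / √(N : ℝ) := by
    rw [Real.rpow_sub hN0, Real.sqrt_eq_rpow, ← Real.rpow_natCast ((N : ℝ) ^ (1 / 2 : ℝ)),
      ← Real.rpow_mul hN0.le]
    congr 2
    ring
  have hk : (k.factorial : ℝ) ≠ 0 := by positivity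
  simp only [spikeMatrix, Matrix.smul_apply, Matrix.vecMulVec_apply, smul_eq_mul, h1, shift,
    mul_pow, div_pow]
  field_simp

/-- The remainder of the model matrix after removal of its Wigner part and of the spike. -/
noncomputable def errorMatrix {N : ℕ} (μ : Measure ℝ) (f : ℝ → ℝ) (k : ℕ) (θ σ γ : ℝ)
    (x : Fin N → ℝ) (z : UpperPair N → ℝ) : Matrix (Fin N) (Fin N) ℝ :=
  modelMatrix μ f γ x (symmMatrix z) - σ • wignerMatrix f (∫ z, f z ∂μ) σ z
    - spikeMatrix k θ γ x

theorem errorMatrix_isSymm {N : ℕ} (μ : Measure ℝ) (f : ℝ → ℝ) (k : ℕ) (θ σ γ : ℝ)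
    (x : Fin N → ℝ) (z : UpperPair N → ℝ) : (errorMatrix μ f k θ σ γ x z).IsSymm :=
  ((modelMatrix_isSymm μ f γ x z).sub ((symmMatrix_isSymm _).smul _)).sub
    (spikeMatrix_isSymm k θ γ x)

theorem measurable_errorMatrix {N : ℕ} (μ : Measure ℝ) {f : ℝ → ℝ} (hf : Measurable f) (k : ℕ)
    (θ σ γ : ℝ) (i j : Fin N) : Measurable fun ω : (Fin N → ℝ) × (UpperPair N → ℝ) =>
      errorMatrix μ f k θ σ γ ω.1 ω.2 i j := by
  simp only [errorMatrix, Matrix.sub_apply, Matrix.smul_apply]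
  refine ((measurable_modelMatrix μ hf γ i j).sub
    (((measurable_wignerMatrix hf _ σ i j).comp measurable_snd).const_smul σ)).sub ?_
  simp only [spikeMatrix, Matrix.smul_apply, Matrix.vecMulVec_apply]
  fun_prop

/-- The remainder is the sum of a fluctuating part, which is centered given the signal, and of the
Taylor remainders of the shifted means. -/
theorem errorMatrix_eq {N : ℕ} (hN : 1 ≤ N) (μ : Measure ℝ) (f : ℝ → ℝ) (k : ℕ) (θ γ : ℝ)
    {σ : ℝ} (hσ : σ ≠ 0) (x : Fin N → ℝ) (z : UpperPair N → ℝ) :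
    errorMatrix μ f k θ σ γ x z = (1 / √(N : ℝ)) • noiseMatrix μ f γ x z
      + Matrix.of fun i j => 1 / √(N : ℝ) * (∫ u, f (u + shift γ x i j) ∂μ - ∫ u, f u ∂μ
        - θ * shift γ x i j ^ k / (k.factorial : ℝ)) := by
  ext i j
  simp only [errorMatrix, Matrix.sub_apply, Matrix.smul_apply, Matrix.add_apply, Matrix.of_apply,
    modelMatrix_apply_symmMatrix, spikeMatrix_apply hN, noiseMatrix_apply, noise, wignerMatrix,
    smul_eq_mul]
  simp only [symmMatrix, Matrix.of_apply]
  field_simp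
  ring

theorem withHighProbability_opNorm_errorMatrix_le {π μ : Measure ℝ} [IsProbabilityMeasure π]
    [IsProbabilityMeasure μ] (hπ : StretchedExpTails π) (hμ : StretchedExpTails μ) {f : ℝ → ℝ}
    {C : ℝ} {β : ℕ} (hf : PolyLip C β f) {k : ℕ} {θ σ : ℝ} (hσ : σ ≠ 0) {K : ℝ} {b : ℕ}
    (hK : 0 ≤ K)
    (hT : ∀ s, |∫ z, f (z + s) ∂μ - ∫ z, f z ∂μ - θ * s ^ k / (k.factorial : ℝ)|
      ≤ K * (1 + |s|) ^ b * |s| ^ (k + 1))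
    {γ : ℕ → ℝ}
    (hγ : Tendsto (fun N : ℕ => |γ N| ^ (k + 1) / (N : ℝ) ^ ((k : ℝ) / 2)) atTop (𝓝 0))
    {ε : ℝ} (hε : 0 < ε) :
    WithHighProbability (modelLaw π μ)
      (fun N => {ω | opNorm (errorMatrix μ f k θ σ (γ N) ω.1 ω.2) ≤ ε}) := by
  set δ : ℕ → ℝ := fun N => (|γ N| / √(N : ℝ)) ^ (k + 1) * √(N : ℝ) with hδ
  have hδe : ∀ N : ℕ, 1 ≤ N → δ N = |γ N| ^ (k + 1) / (N : ℝ) ^ ((k : ℝ) / 2) := by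
    intro N hN
    have hN0 : (0 : ℝ) < N := by exact_mod_cast hN
    have hs : 0 < √(N : ℝ) := Real.sqrt_pos.2 hN0
    have h1 : (N : ℝ) ^ ((k : ℝ) / 2) = √(N : ℝ) ^ k := by
      rw [Real.sqrt_eq_rpow, ← Real.rpow_natCast, ← Real.rpow_mul hN0.le]
      congr 1
      ring
    simp only [hδ, h1, div_pow, pow_succ (√(N : ℝ)) k]
    field_simp
  have hδ0 : Tendsto δ atTop (𝓝 0) := by
    refine hγ.congr' ?_
    filter_upwards [eventually_ge_atTop 1] with N hN using (hδe N hN).symm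
  obtain ⟨G, hG⟩ := hδ0.bddAbove_range
  have hG' : ∀ N : ℕ, 1 ≤ N → (|γ N| / √(N : ℝ)) ^ (k + 1) * √(N : ℝ) ≤ G := fun N _ =>
    hG ⟨N, rfl⟩
  have hG0 : 0 ≤ G := le_trans (by positivity) (hG' 1 le_rfl)
  have hr := fun (N : ℕ) (hN : 1 ≤ N) => abs_div_sqrt_le (hG' N hN) hN
  obtain ⟨T, V, hV, hT0, hprob⟩ := exists_prob_empirical_moment_le hπ (2 * (b + (k + 1)))
  obtain ⟨K', hK', hnoise⟩ := exists_noise_prob_le hπ hμ hf hG' (half_pos hε)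
  have hsmall : ∀ᶠ N : ℕ in atTop, K * (1 + (1 + G)) ^ b * δ N * T ≤ ε / 2 := by
    have : Tendsto (fun N => K * (1 + (1 + G)) ^ b * δ N * T) atTop (𝓝 0) := by
      simpa using (hδ0.const_mul (K * (1 + (1 + G)) ^ b)).mul_const T
    exact this.eventually_le_const (half_pos hε)
  obtain ⟨N₀, hN₀⟩ := eventually_atTop.1 hsmall
  refine ⟨1, one_pos, K' + V + N₀ + 1, by positivity, fun N hN => ?_⟩
  have hNpos : (0 : ℝ) < N := by exact_mod_cast hN
  rw [Real.rpow_neg_one, ← div_eq_mul_inv]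
  -- The summand `N₀` of the constant makes the bound trivial for `N < N₀`.
  by_cases hlt : N < N₀
  · have : 1 ≤ (K' + V + N₀ + 1) / (N : ℝ) := by
      rw [one_le_div hNpos]
      have : (N : ℝ) ≤ N₀ := by exact_mod_cast hlt.le
      linarith
    exact le_trans (by linarith) measureReal_nonneg
  · push Not at hlt
    set S : Set ((Fin N → ℝ) × (UpperPair N → ℝ)) :=
      {ω | opNorm (errorMatrix μ f k θ σ (γ N) ω.1 ω.2) ≤ ε} with hS
    set B₁ : Set ((Fin N → ℝ) × (UpperPair N → ℝ)) :=
      {ω | ε / 2 < opNorm ((1 / √(N : ℝ)) • noiseMatrix μ f (γ N) ω.1 ω.2)} with hB₁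
    set B₂ : Set (Fin N → ℝ) :=
      {x | T * N < ∑ l, (1 + |x l|) ^ (2 * (b + (k + 1)))} with hB₂
    have hcover : Set.univ ⊆ S ∪ (B₁ ∪ Prod.fst ⁻¹' B₂) := by
      intro ω _
      by_contra hnot
      simp only [hS, hB₁, hB₂, Set.mem_union, Set.mem_ofPred_eq, Set.mem_preimage, not_or,
        not_lt, not_le] at hnot
      obtain ⟨h1, h2, h3⟩ := hnot
      rw [errorMatrix_eq hN μ f k θ (γ N) hσ] at h1
      have h4 := opNorm_bias_le hN hK hT (hr N hN) ω.1
      have h5 : (∑ l, (1 + |ω.1 l|) ^ (2 * (b + (k + 1)))) / (N : ℝ) ≤ T := by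
        rwa [div_le_iff₀ hNpos]
      have h6 := hN₀ N hlt
      have h7 : K * (1 + (1 + G)) ^ b * δ N
          * ((∑ l, (1 + |ω.1 l|) ^ (2 * (b + (k + 1)))) / N)
          ≤ K * (1 + (1 + G)) ^ b * δ N * T := by
        gcongr
      have h8 := opNorm_add_le ((1 / √(N : ℝ)) • noiseMatrix μ f (γ N) ω.1 ω.2)
        (Matrix.of fun i j => 1 / √(N : ℝ) * (∫ u, f (u + shift (γ N) ω.1 i j) ∂μ
          - ∫ u, f u ∂μ - θ * shift (γ N) ω.1 i j ^ k / (k.factorial : ℝ)))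
      linarith
    have hB₂' : (modelLaw π μ N).real (Prod.fst ⁻¹' B₂) ≤ V / N := by
      have hmeas : MeasurableSet B₂ := measurableSet_lt measurable_const (by fun_prop)
      have hmp : MeasurePreserving Prod.fst (modelLaw π μ N) (Measure.pi fun _ : Fin N => π) :=
        measurePreserving_fst
      rw [hmp.measureReal_preimage hmeas.nullMeasurableSet]
      exact hprob N hN
    have hB₁' : (modelLaw π μ N).real B₁ ≤ K' / N := hnoise N hN
    have hone : 1 ≤ (modelLaw π μ N).real S + ((modelLaw π μ N).real B₁
        + (modelLaw π μ N).real (Prod.fst ⁻¹' B₂)) := by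
      calc (1 : ℝ) = (modelLaw π μ N).real Set.univ := by simp
        _ ≤ (modelLaw π μ N).real (S ∪ (B₁ ∪ Prod.fst ⁻¹' B₂)) := measureReal_mono hcover
        _ ≤ _ := (measureReal_union_le _ _).trans
            (add_le_add le_rfl (measureReal_union_le _ _))
    have hsplit : (K' + V + N₀ + 1) / (N : ℝ) = K' / N + V / N + (N₀ + 1) / N := by ring
    have : 0 ≤ ((N₀ : ℝ) + 1) / N := by positivity
    linarith

/-- The variance of `f(Z)` is positive, because `f` has an information index. -/
theorem IsInfoIndex.variance_pos {μ : Measure ℝ} [IsProbabilityMeasure μ]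
    (hμ : StretchedExpTails μ) {f : ℝ → ℝ} (hf4 : MemLp f 4 μ) {k : ℕ} {θ : ℝ}
    (hk : IsInfoIndex μ f k θ) : 0 < ∫ z, f z ^ 2 ∂μ - (∫ z, f z ∂μ) ^ 2 := by
  have h2 : MemLp f 2 μ := hf4.mono_exponent (by norm_num)
  have hv : variance f μ = ∫ z, f z ^ 2 ∂μ - (∫ z, f z ∂μ) ^ 2 := by
    simpa using variance_eq_sub h2
  rw [← hv]
  refine (variance_nonneg f μ).lt_of_ne' fun h0 => ?_
  have hev : evariance f μ = 0 := by
    rw [← h2.ofReal_variance_eq, h0, ENNReal.ofReal_zero]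
  exact hk.not_ae_const hμ hf4 _ ((evariance_eq_zero_iff h2.1.aemeasurable).1 hev)

end NonlinearSpike

open NonlinearSpike in
theorem theorem2p2
    -- laws of the signal and of the noise
    (πX μZ : Measure ℝ) [IsProbabilityMeasure πX] [IsProbabilityMeasure μZ]
    (hX : NonlinearSpike.StretchedExpTails πX) (hX0 : πX ≠ Measure.dirac 0)
    (hZ : NonlinearSpike.StretchedExpTails μZ)
    -- non-linearity, information index and coefficient
    (f : ℝ → ℝ) (hf4 : MemLp f 4 μZ) (hfLip : NonlinearSpike.LocLipschitzPoly f)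
    (k : ℕ) (θ : ℝ) (hk : NonlinearSpike.IsInfoIndex μZ f k θ)
    -- signal-to-noise ratio
    (γ : ℕ → ℝ)
    (hγ : ∀ Q : Polynomial ℝ, Tendsto
      (fun N : ℕ => Q.eval (Real.log N) * |γ N| ^ (k + 1) / (N : ℝ) ^ ((k : ℝ) / 2)) atTop (𝓝 0))
    -- signal and noise in every dimension
    {Ω : ℕ → Type*} [∀ N, MeasurableSpace (Ω N)] (P : ∀ N, Measure (Ω N))
    [∀ N, IsProbabilityMeasure (P N)]
    (x : ∀ N, Ω N → Fin N → ℝ) (Z : ∀ N, Ω N → Matrix (Fin N) (Fin N) ℝ)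
    (hx : ∀ N, NonlinearSpike.IsIID (fun i ω => x N ω i) πX (P N))
    (hZN : ∀ N, NonlinearSpike.IsSymmIID (Z N) μZ (P N))
    (hxZ : ∀ N, IndepFun (x N) (fun ω i j => Z N ω i j) (P N)) :
    ∃ (Ω' : ℕ → Type) (_ : ∀ N, MeasurableSpace (Ω' N)) (P' : ∀ N, Measure (Ω' N))
      (x' : ∀ N, Ω' N → Fin N → ℝ) (W E : ∀ N, Ω' N → Matrix (Fin N) (Fin N) ℝ),
      (∀ N, IsProbabilityMeasure (P' N)) ∧
      (∀ N, Measurable (x' N)) ∧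
      (∀ N i j, Measurable fun ω => W N ω i j) ∧
      (∀ N i j, Measurable fun ω => E N ω i j) ∧
      -- equality in law, jointly with the signal
      (∀ N, 1 ≤ N → IdentDistrib
        (fun ω => (x N ω, fun i j =>
          NonlinearSpike.modelMatrix μZ f (γ N) (x N ω) (Z N ω) i j))
        (fun ω => (x' N ω, fun i j =>
          (√(NonlinearSpike.infoCoeff μZ 0 (f ^ 2) - NonlinearSpike.infoCoeff μZ 0 f ^ 2) • W N ω
            + NonlinearSpike.spikeMatrix k θ (γ N) (x' N ω) + E N ω) i j))
        (P N) (P' N)) ∧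
      NonlinearSpike.IsNormalizedWigner W P' ∧
      (∀ N, IndepFun (x' N) (fun ω i j => W N ω i j) (P' N)) ∧
      (∀ N ω, (E N ω).IsSymm) ∧
      ∀ ε > (0 : ℝ), NonlinearSpike.WithHighProbability P'
        (fun N => {ω | NonlinearSpike.opNorm (E N ω) ≤ ε}) := by
  obtain ⟨C, β, hf⟩ := hfLip.exists_polyLip
  have hfm : Measurable f := hf.continuous.measurable
  obtain ⟨F, hF⟩ := hk.1
  obtain ⟨K, b, hK, hT⟩ := exists_abs_integral_shift_sub_le hZ hF.one_le
    (fun j h1 h2 => hk.exists_infoCoeff_bound hf4 h1 h2) hf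
    (fun t => ⟨hF.smooth t, hF.hasCompactSupport t⟩) hF.tendsto_L4 hF.tendsto_lower
    hF.tendsto_top
  have hvar := hk.variance_pos hZ hf4
  have hσeq : infoCoeff μZ 0 (f ^ 2) - infoCoeff μZ 0 f ^ 2
      = ∫ z, f z ^ 2 ∂μZ - (∫ z, f z ∂μZ) ^ 2 := by simp [infoCoeff]
  rw [hσeq]
  set σ := √(∫ z, f z ^ 2 ∂μZ - (∫ z, f z ∂μZ) ^ 2) with hσ
  have hσ0 : 0 < σ := Real.sqrt_pos.2 hvar
  have hγ1 : Tendsto (fun N : ℕ => |γ N| ^ (k + 1) / (N : ℝ) ^ ((k : ℝ) / 2)) atTop (𝓝 0) := by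
    simpa using hγ 1
  refine ⟨fun N => (Fin N → ℝ) × (UpperPair N → ℝ), fun N => inferInstance, modelLaw πX μZ,
    fun N ω => ω.1, fun N ω => wignerMatrix f (∫ z, f z ∂μZ) σ ω.2,
    fun N ω => errorMatrix μZ f k θ σ (γ N) ω.1 ω.2, fun N => inferInstance,
    fun N => measurable_fst,
    fun N i j => (measurable_wignerMatrix hfm _ σ i j).comp measurable_snd,
    fun N i j => measurable_errorMatrix μZ hfm k θ σ (γ N) i j, fun N _ => ?_,
    isNormalizedWigner_wignerMatrix hfm hf4 hσ0 (Real.sq_sqrt hvar.le), fun N => ?_,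
    fun N ω => errorMatrix_isSymm μZ f k θ σ (γ N) ω.1 ω.2,
    fun ε hε => withHighProbability_opNorm_errorMatrix_le hX hZ hf hσ0.ne' hK hT hγ1 hε⟩
  · have hid := identDistrib_signal_noise (hx N) (hZN N) (hxZ N)
    have hG : Measurable fun ω : (Fin N → ℝ) × (UpperPair N → ℝ) =>
        (ω.1, fun i j => modelMatrix μZ f (γ N) ω.1 (symmMatrix ω.2) i j) :=
      measurable_fst.prodMk (measurable_pi_lambda _ fun i => measurable_pi_lambda _ fun j =>
        measurable_modelMatrix μZ hfm (γ N) i j)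
    convert hid.comp hG using 1
    · funext ω
      simp only [Function.comp_apply, symmMatrix_upper ((hZN N).symm ω)]
    · funext ω
      simp [errorMatrix]
  · exact indepFun_prod (X := id)
      (Y := fun (z : UpperPair N → ℝ) i j => wignerMatrix f (∫ z, f z ∂μZ) σ z i j)
      measurable_id (measurable_pi_lambda _ fun i => measurable_pi_lambda _ fun j =>
        measurable_wignerMatrix hfm _ σ i j)
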